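/- Let $p$ be a prime and let $O$ be a compact connected hyperbolic 2-orbifold with non-empty (geodesic) boundary and no reflector curves. That is, $O = X/G$, where $X$ is a closed geodesically convex subset of the hyperbolic plane $\mathbb{H}^2$ with non-empty interior whose frontier is a non-empty union of complete geodesics, and $G = \pi_1^{\mathrm{orb}}(O)$ is a group of (possibly orientation-reversing) isometries of $\mathbb{H}^2$ that preserves $X$, acts properly discontinuously on $X$ with compact quotient, and contains no reflections. Suppose that $G$ is residually $p$, i.e. every non-trivial element of $G$ has non-trivial image in some finite $p$-group quotient of $G$. Let $D \le G$ be the fundamental group of a boundary component of $O$, i.e. the stabiliser in $G$ of a geodesic contained in the frontier of $X$. Then $D$ is cyclic, and $D$ is conjugacy $p$-distinguished in $G$: for every $g \in G$ that is not conjugate in $G$ to any element of $D$, there is a surjective homomorphism $\phi : G \to P$ onto a finite $p$-group $P$ such that $\phi(g)$ is not conjugate in $P$ to any element of $\phi(D)$. -/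

import Mathlib

/-! ### Residual properties with respect to finite `p`-groups -/

/-- `G` is residually `p`: every nontrivial element survives in some finite `p`-group quotient. -/
def IsResiduallyP (p : ℕ) (G : Type) [Group G] : Prop :=
  ∀ g : G, g ≠ 1 → ∃ (P : Type) (_ : Group P) (_ : Finite P) (φ : G →* P),
    IsPGroup p P ∧ Function.Surjective φ ∧ φ g ≠ 1

/-- `S` is conjugacy `p`-distinguished in `G`: every `g` that is not conjugate to an element of `S`
has, in some finite `p`-group quotient, an image not conjugate to the image of any element
of `S`. -/
def IsConjPDistinguished (p : ℕ) {G : Type} [Group G] (S : Set G) : Prop :=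
  ∀ g : G, (∀ s ∈ S, ¬ IsConj g s) →
    ∃ (P : Type) (_ : Group P) (_ : Finite P) (φ : G →* P),
      IsPGroup p P ∧ Function.Surjective φ ∧ ∀ s ∈ S, ¬ IsConj (φ g) (φ s)

/-! ### Geometry of the hyperbolic plane

The hyperbolic plane is `UpperHalfPlane` with its hyperbolic metric; its isometries, orientation
reversing ones included, form the group `UpperHalfPlane ≃ᵢ UpperHalfPlane`. -/

/-- A complete geodesic of the hyperbolic plane: the image of an isometric embedding of `ℝ`. -/
def IsGeodesicLine (L : Set UpperHalfPlane) : Prop :=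
  ∃ γ : ℝ → UpperHalfPlane, Isometry γ ∧ Set.range γ = L

/-- Geodesic convexity: together with `x` and `y` the set contains the geodesic segment from `x`
to `y`, which consists of the points `z` with `dist x z + dist z y = dist x y`. -/
def IsHypConvex (X : Set UpperHalfPlane) : Prop :=
  ∀ x ∈ X, ∀ y ∈ X, ∀ z : UpperHalfPlane, dist x z + dist z y = dist x y → z ∈ X

/-- The reflection in a complete geodesic: a nontrivial isometry fixing it pointwise. -/
def IsHypReflection (g : UpperHalfPlane ≃ᵢ UpperHalfPlane) : Prop :=
  g ≠ 1 ∧ ∃ L : Set UpperHalfPlane, IsGeodesicLine L ∧ ∀ x ∈ L, g x = x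

/-! ### Hyperbolic 2-orbifolds -/

/-- A compact (connected) hyperbolic 2-orbifold `O`, with possibly empty geodesic boundary, given
as the quotient of its universal cover by its orbifold fundamental group. The universal cover is a
closed convex region `cover` of the hyperbolic plane with nonempty interior, bounded by complete
geodesics; `pi1` is a group of isometries acting on it properly discontinuously with compact
quotient. Thus `O = cover / pi1`, the orbifold fundamental group of `O` (the deck group of
the universal cover `cover → O`) is `pi1`, and the boundary of `O` is `frontier cover / pi1`. -/
structure HyperbolicTwoOrbifold where
  /-- the universal cover of `O` -/
  cover : Set UpperHalfPlane
  /-- the orbifold fundamental group of `O` -/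
  pi1 : Subgroup (UpperHalfPlane ≃ᵢ UpperHalfPlane)
  isClosed_cover : IsClosed cover
  interior_nonempty : (interior cover).Nonempty
  convex_cover : IsHypConvex cover
  geodesic_boundary : ∀ x ∈ frontier cover,
    ∃ L : Set UpperHalfPlane, IsGeodesicLine L ∧ x ∈ L ∧ L ⊆ frontier cover
  image_cover : ∀ g ∈ pi1, g '' cover = cover
  properlyDiscontinuous : ∀ K : Set UpperHalfPlane, IsCompact K → K ⊆ cover →
    {g : UpperHalfPlane ≃ᵢ UpperHalfPlane | g ∈ pi1 ∧ (g '' K ∩ K).Nonempty}.Finite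
  cocompact : ∃ K : Set UpperHalfPlane, IsCompact K ∧ K ⊆ cover ∧
    ∀ x ∈ cover, ∃ g ∈ pi1, g x ∈ K

namespace HyperbolicTwoOrbifold

/-- The boundary `frontier cover / pi1` of `O` is not empty. -/
def HasBoundary (O : HyperbolicTwoOrbifold) : Prop :=
  (frontier O.cover).Nonempty

/-- The singular locus of `O` contains no reflector curve: no element of the orbifold fundamental
group acts on the universal cover as a reflection. -/
def HasNoReflectors (O : HyperbolicTwoOrbifold) : Prop :=
  ∀ g ∈ O.pi1, ¬ IsHypReflection g

/-- `L` is a boundary geodesic of the universal cover, that is, a lift of a boundary component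
of `O`. The boundary components of `O` are the `pi1`-orbits of these geodesics. -/
def IsBoundaryLift (O : HyperbolicTwoOrbifold) (L : Set UpperHalfPlane) : Prop :=
  IsGeodesicLine L ∧ L ⊆ frontier O.cover

/-- The subgroup of the orbifold fundamental group that stabilises a set `L`. If `L` is a lift of a
boundary component then the component is `L` modulo this subgroup, and the subgroup is the image of
its fundamental group; another lift of the same component gives a conjugate subgroup. -/
def boundarySubgroup (O : HyperbolicTwoOrbifold) (L : Set UpperHalfPlane) : Subgroup O.pi1 where
  carrier := {g | (g : UpperHalfPlane ≃ᵢ UpperHalfPlane) '' L = L}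
  one_mem' := by
    change (id : UpperHalfPlane → UpperHalfPlane) '' L = L
    exact Set.image_id L
  mul_mem' := by
    intro a b ha hb
    change ((a : UpperHalfPlane ≃ᵢ UpperHalfPlane) ∘
      (b : UpperHalfPlane ≃ᵢ UpperHalfPlane)) '' L = L
    rw [Set.image_comp]
    exact (congrArg _ hb).trans ha
  inv_mem' := by
    intro a ha
    change (a : UpperHalfPlane ≃ᵢ UpperHalfPlane).symm '' L = L
    have h : (a : UpperHalfPlane ≃ᵢ UpperHalfPlane) '' L = L := ha
    conv_lhs => rw [← h]
    rw [← Set.image_comp]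
    simp

end HyperbolicTwoOrbifold

/-! ### Unitriangular matrices over `ℤ / p ^ E` -/

/-! Geometry. Without reflections, nothing nontrivial fixes a boundary geodesic `γ` pointwise or
flips it, and proper discontinuity makes the translation lengths discrete; so the stabiliser of `γ`
is generated by one translation `d` (`exists_generator`). If `γ` is the whole frontier, then `D = G`
and nothing is to be separated; if `d = 1`, the claim is residual `p`-ness. Otherwise join `γ` to a
second boundary geodesic `δ` by a geodesic arc. Only finitely many group elements move the arc to
something meeting it, so some finite `p`-quotient has a kernel `N` whose nontrivial elements move
the arc off itself, and which never carries `γ` to `δ`. In the quotient of the cover by `N`, the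
boundary curve of `γ` meets the embedded arc exactly once. Cutting along the arc gives `N = ⟨d'⟩ *
H`, where `d'` is the least power of `d` in `N`. `IsNestedHalf` records the combinatorics of the
sides of the arc, and ping-pong yields the free product.

Algebra (`exists_hom_of_freeSplitting`). Let `n ∈ N` be conjugate to no power of `d'`. If the
retraction onto `H` killing `d'` does not kill `n`, residual `p`-ness of `H` suffices. Otherwise `n`
is conjugate to a cyclically reduced product of conjugates `y i * d' ^ b i * (y i)⁻¹`. In a wreath
product of unitriangular matrices over `ℤ / p ^ E` by a finite `p`-quotient of `H`, the coordinates
of `d'` are `1 + X` with `X ^ 2 = 0`, while `n` has a coordinate `M` with `(M - 1) ^ 2 ≠ 0`.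

Descent (`isConjPDistinguished_of_normal`). For `g ∈ G` a power `g ^ p ^ a` lies in `N`. If it is
nontrivial, its conjugates are not conjugate in `N` to powers of `d'`, since the centraliser of a
nontrivial power of `d` is contained in `⟨d⟩`; separating finitely many of them in `N` and passing
to a normal core separates `g` in `G`. If it is trivial, a comparison of orders suffices.

The plane is handled in the hyperboloid model: segments are nonnegative combinations, lines are zero
sets of linear functionals, and sides are signs. -/

theorem exists_one_add_pow_prime_pow_eq_one {R : Type*} [Ring R] {p : ℕ} (hp : p.Prime) {x : R}
    {n E : ℕ} (hx : x ^ n = 0) (hE : (p : R) ^ E = 0) : ∃ m, (1 + x) ^ p ^ m = 1 := by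
  -- Each `p`-th power gains at least one factor `p` in the term added to `1`, and `p ^ E = 0` ends
  -- the process.
  have key : ∀ (k : ℕ) (y : R), (1 + (p : R) ^ (k + 1) * y) ^ p ^ (E - (k + 1)) = 1 := by
    intro k
    induction h : E - (k + 1) generalizing k with
    | zero =>
      intro y
      have : (p : R) ^ (k + 1) = 0 := pow_eq_zero_of_le (by omega) hE
      simp [this]
    | succ m ih =>
      intro y
      obtain ⟨r, hr⟩ := (Commute.one_left ((p : R) ^ (k + 1) * y)).exists_add_pow_prime_eq hp
      have hc : Commute ((p : R) ^ (k + 1)) y := (Nat.cast_commute p y).pow_left _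
      have : ∃ z, (1 + (p : R) ^ (k + 1) * y) ^ p = 1 + (p : R) ^ (k + 1 + 1) * z := by
        obtain ⟨c, hcp⟩ : ∃ c, (k + 1) * p = (k + 1 + 1) + c :=
          ⟨(k + 1) * p - (k + 2), by have := Nat.mul_le_mul_left (k + 1) hp.two_le; omega⟩
        refine ⟨(p : R) ^ c * y ^ p + y * r, ?_⟩
        rw [hr, hc.mul_pow, ← pow_mul, hcp, pow_add _ _ c, pow_succ' (p : R) (k + 1)]
        simp only [one_pow, mul_one, mul_assoc, mul_add, add_assoc]
      obtain ⟨z, hz⟩ := this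
      rw [pow_succ' p m, pow_mul, hz]
      exact ih (k + 1) (by omega) z
  obtain ⟨r, hr⟩ := (Commute.one_left x).exists_add_pow_prime_pow_eq hp n
  have hxn : x ^ p ^ n = 0 := pow_eq_zero_of_le (Nat.lt_pow_self hp.one_lt).le hx
  refine ⟨n + (E - (0 + 1)), ?_⟩
  have h2 := key 0 (x * r)
  rw [pow_add, pow_mul, hr, hxn]
  simpa [mul_assoc] using h2

/-- A square matrix that vanishes on and below the diagonal. -/
def IsStrictlyUpper {R : Type*} [Ring R] {n : ℕ} (M : Matrix (Fin n) (Fin n) R) : Prop :=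
  ∀ i j, j ≤ i → M i j = 0

theorem IsStrictlyUpper.mul {R : Type*} [Ring R] {n : ℕ} {M N : Matrix (Fin n) (Fin n) R}
    (hM : IsStrictlyUpper M) (hN : IsStrictlyUpper N) : IsStrictlyUpper (M * N) := by
  intro i j hij
  rw [Matrix.mul_apply]
  refine Finset.sum_eq_zero fun k _ => ?_
  rcases le_or_gt k i with h | h
  · rw [hM i k h, zero_mul]
  · rw [hN k j (hij.trans h.le), mul_zero]

theorem IsStrictlyUpper.add {R : Type*} [Ring R] {n : ℕ} {M N : Matrix (Fin n) (Fin n) R}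
    (hM : IsStrictlyUpper M) (hN : IsStrictlyUpper N) : IsStrictlyUpper (M + N) := by
  intro i j hij
  rw [Matrix.add_apply, hM i j hij, hN i j hij, add_zero]

theorem IsStrictlyUpper.pow_apply {R : Type*} [Ring R] {n : ℕ} {M : Matrix (Fin n) (Fin n) R}
    (hM : IsStrictlyUpper M) (k : ℕ) (i j : Fin n) (h : (j : ℕ) < i + k) : (M ^ k) i j = 0 := by
  induction k generalizing j with
  | zero => rw [pow_zero, Matrix.one_apply_ne]; rintro rfl; omega
  | succ k ih =>
    rw [pow_succ, Matrix.mul_apply]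
    refine Finset.sum_eq_zero fun l _ => ?_
    rcases lt_or_ge (l : ℕ) (i + k) with h' | h'
    · rw [ih l h', zero_mul]
    · rw [hM l j (Fin.le_def.2 (by omega)), mul_zero]

theorem IsStrictlyUpper.pow_eq_zero {R : Type*} [Ring R] {n : ℕ} {M : Matrix (Fin n) (Fin n) R}
    (hM : IsStrictlyUpper M) : M ^ n = 0 := by
  ext i j
  exact hM.pow_apply n i j (by omega)

/-- The group of unitriangular matrices over `ℤ / p ^ E`. -/
def unitriangular (p E n : ℕ) (hp : p.Prime) :
    Subgroup (Matrix (Fin n) (Fin n) (ZMod (p ^ E)))ˣ where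
  carrier := {u | IsStrictlyUpper (u.val - 1)}
  one_mem' := by
    change IsStrictlyUpper (1 - 1)
    rw [sub_self]
    exact fun _ _ _ => rfl
  mul_mem' := by
    intro a b ha hb
    have h : (a * b).val - 1 = (a.val - 1) * (b.val - 1) + ((a.val - 1) + (b.val - 1)) := by
      rw [Units.val_mul]; noncomm_ring
    change IsStrictlyUpper ((a * b).val - 1)
    rw [h]
    exact (IsStrictlyUpper.mul ha hb).add (IsStrictlyUpper.add ha hb)
  inv_mem' := by
    intro a ha
    -- Elements have finite order, so inverses are natural powers and closure under products is
    -- enough.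
    have hmul : ∀ k : ℕ, IsStrictlyUpper ((a ^ k).val - 1) := by
      intro k
      induction k with
      | zero => rw [pow_zero, Units.val_one, sub_self]; exact fun _ _ _ => rfl
      | succ k ih =>
        have h : (a ^ (k + 1)).val - 1 =
            ((a ^ k).val - 1) * (a.val - 1) + (((a ^ k).val - 1) + (a.val - 1)) := by
          rw [pow_succ, Units.val_mul]; noncomm_ring
        rw [h]
        exact (IsStrictlyUpper.mul ih ha).add (IsStrictlyUpper.add ih ha)
    have hE : ((p : Matrix (Fin n) (Fin n) (ZMod (p ^ E)))) ^ E = 0 := by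
      rw [← Nat.cast_pow]
      ext i j
      rw [Matrix.natCast_apply]
      simp
    obtain ⟨m, hm⟩ := exists_one_add_pow_prime_pow_eq_one hp (IsStrictlyUpper.pow_eq_zero ha) hE
    have h1 : a ^ p ^ m = 1 := by
      ext1
      rw [Units.val_pow_eq_pow_val, Units.val_one, ← hm]
      simp
    have h2 : a⁻¹ = a ^ (p ^ m - 1) := by
      rw [inv_eq_iff_mul_eq_one, ← pow_succ', Nat.sub_add_cancel (Nat.pow_pos hp.pos), h1]
    change IsStrictlyUpper ((a⁻¹).val - 1)
    rw [h2]
    exact hmul _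

theorem isPGroup_unitriangular (p E n : ℕ) (hp : p.Prime) :
    IsPGroup p (unitriangular p E n hp) := by
  rintro ⟨a, ha⟩
  have hE : ((p : Matrix (Fin n) (Fin n) (ZMod (p ^ E)))) ^ E = 0 := by
    rw [← Nat.cast_pow]
    ext i j
    rw [Matrix.natCast_apply]
    simp
  obtain ⟨m, hm⟩ := exists_one_add_pow_prime_pow_eq_one hp (IsStrictlyUpper.pow_eq_zero ha) hE
  refine ⟨m, Subtype.ext (Units.ext ?_)⟩
  change (a ^ p ^ m).val = 1
  rw [Units.val_pow_eq_pow_val, ← hm]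
  simp

theorem finite_unitriangular (p E n : ℕ) (hp : p.Prime) : Finite (unitriangular p E n hp) := by
  have : NeZero (p ^ E) := ⟨(Nat.pow_pos hp.pos).ne'⟩
  have : Finite (Matrix (Fin n) (Fin n) (ZMod (p ^ E))) :=
    inferInstanceAs (Finite (Fin n → Fin n → ZMod (p ^ E)))
  infer_instance

/-! ### Products of matrices `1 + b X` with `X` of square zero -/

theorem zpow_unit_of_sq_zero {R : Type*} [Ring R] {x : R} (hx : x * x = 0) (u : Rˣ)
    (hu : u.val = 1 + x) (k : ℤ) : (u ^ k).val = 1 + (k : R) * x := by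
  have hinv : (u⁻¹).val = 1 - x := by
    rw [Units.inv_eq_of_mul_eq_one_right]
    rw [hu]
    have : (1 + x) * (1 - x) = 1 - x * x := by noncomm_ring
    rw [this, hx, sub_zero]
  induction k with
  | zero => simp
  | succ k ih =>
    rw [zpow_add_one, Units.val_mul, ih, hu]
    push_cast
    rw [add_mul, mul_add, mul_add, mul_assoc _ x x, hx]
    simp [add_mul]; abel
  | pred k ih =>
    rw [zpow_sub_one, Units.val_mul, ih, hinv]
    push_cast
    rw [add_mul, mul_sub, mul_sub, mul_assoc _ x x, hx]
    simp [sub_mul]; abel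

/-- The matrix with an entry `1` in position `(i, i + 1)` for every `i` with `y i = q`. -/
def stepMatrix (R : Type*) [Ring R] {Q : Type*} [DecidableEq Q] (y : ℕ → Q) (n : ℕ) (q : Q) :
    Matrix (Fin (n + 1)) (Fin (n + 1)) R :=
  fun i j => if (j : ℕ) = i + 1 ∧ y i = q then 1 else 0

/-- A nonzero entry would need consecutive steps `i → i + 1 → i + 2` with the same label. -/
theorem stepMatrix_sq (R : Type*) [Ring R] {Q : Type*} [DecidableEq Q] (y : ℕ → Q) (n : ℕ) (q : Q)
    (hy : ∀ i, y i ≠ y (i + 1)) : stepMatrix R y n q * stepMatrix R y n q = 0 := by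
  ext i j
  rw [Matrix.mul_apply]
  refine Finset.sum_eq_zero fun k _ => ?_
  simp only [stepMatrix]
  by_cases h : (k : ℕ) = i + 1 ∧ y i = q
  · rw [if_neg (c := (j : ℕ) = k + 1 ∧ y k = q), mul_zero]
    rintro ⟨-, h2⟩
    rw [h.1, ← h.2] at h2
    exact hy i h2.symm
  · rw [if_neg h, zero_mul]

theorem isStrictlyUpper_stepMatrix (R : Type*) [Ring R] {Q : Type*} [DecidableEq Q] (y : ℕ → Q)
    (n : ℕ) (q : Q) : IsStrictlyUpper (stepMatrix R y n q) := by
  intro i j hij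
  rw [stepMatrix, if_neg]
  rintro ⟨h, -⟩
  have := Fin.le_def.1 hij
  omega

/-- Each factor moves at most one column to the right. Reaching column `k` from column `0` in `k`
factors therefore leaves a single path: factor `i` makes the step from `i` to `i + 1`, with weight
`b i`. -/
theorem prod_stepMatrix_apply {R : Type*} [CommRing R] {Q : Type*} [DecidableEq Q] (y : ℕ → Q)
    (b : ℕ → ℤ) (n k : ℕ) :
    (∀ j : Fin (n + 1), k < j →
      (((List.range k).map fun i => 1 + (b i : Matrix (Fin (n + 1)) (Fin (n + 1)) R) *
        stepMatrix R y n (y i)).prod) 0 j = 0) ∧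
    (∀ j : Fin (n + 1), (j : ℕ) = k →
      (((List.range k).map fun i => 1 + (b i : Matrix (Fin (n + 1)) (Fin (n + 1)) R) *
        stepMatrix R y n (y i)).prod) 0 j = ∏ i ∈ Finset.range k, (b i : R)) := by
  induction k with
  | zero =>
    refine ⟨fun j hj => ?_, fun j hj => ?_⟩
    · have : (0 : Fin (n + 1)) ≠ j := by rintro rfl; simp at hj
      simp [this]
    · have : j = 0 := Fin.ext hj
      simp [this]
  | succ k ih =>
    simp only [List.range_succ, List.map_append, List.prod_append, List.map_cons, List.map_nil,
      List.prod_cons, List.prod_nil, mul_one]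
    set W := ((List.range k).map fun i => 1 + (b i : Matrix (Fin (n + 1)) (Fin (n + 1)) R) *
        stepMatrix R y n (y i)).prod with hW
    have hc : ∀ j, (W * (1 + (b k : Matrix (Fin (n + 1)) (Fin (n + 1)) R) *
        stepMatrix R y n (y k))) 0 j = W 0 j + (b k : R) * ∑ l, W 0 l *
          stepMatrix R y n (y k) l j := by
      intro j
      rw [mul_add, mul_one, Matrix.add_apply, ← mul_assoc, (Int.cast_commute (b k) W).symm.eq,
        mul_assoc, ← zsmul_eq_mul, Matrix.smul_apply, Matrix.mul_apply, zsmul_eq_mul]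
    refine ⟨fun j hj => ?_, fun j hj => ?_⟩
    · rw [hc, ih.1 j (by omega), zero_add, Finset.sum_eq_zero, mul_zero]
      intro l _
      by_cases hl : k < (l : ℕ)
      · rw [ih.1 l hl, zero_mul]
      · rw [stepMatrix, if_neg, mul_zero]
        omega
    · rw [hc, ih.1 j (by omega), zero_add, Finset.prod_range_succ, mul_comm]
      have hkn : k < n + 1 := by have := j.2; omega
      rw [Finset.sum_eq_single ⟨k, hkn⟩]
      · rw [ih.2 _ rfl, stepMatrix, if_pos ⟨hj, rfl⟩, mul_one]
      · intro l _ hl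
        rw [stepMatrix, if_neg, mul_zero]
        rintro ⟨h, -⟩
        exact hl (Fin.ext (by simp; omega))
      · simp

/-! ### Free splittings from nested subsets of a group -/

/-- The translates of `A` are nested, any two elements of the group are separated by finitely many
of them, and `A` is the only one that separates `1` from `d`. A translate of `A` is described by the
element that moves it back to `A`. -/
structure IsNestedHalf {N : Type} [Group N] (A : Set N) (d : N) : Prop where
  one_notMem : 1 ∉ A
  mem : d ∈ A
  mem_mul_iff : ∀ m, m ≠ 1 → (m * d ∈ A ↔ m ∈ A)
  finite : ∀ g, {m | ¬(m ∈ A ↔ m * g ∈ A)}.Finite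
  nested : ∀ u v, u ≠ v → ∀ a b c e, u * a ∈ A → v * a ∈ A → u * b ∈ A → v * b ∉ A →
    u * c ∉ A → v * c ∈ A → u * e ∉ A → v * e ∈ A

/-- The right stabiliser of a subset of a group. -/
def rightStabilizer {N : Type} [Group N] (A : Set N) : Subgroup N where
  carrier := {h | ∀ m, m * h ∈ A ↔ m ∈ A}
  one_mem' m := by rw [mul_one]
  mul_mem' {a b} ha hb m := by rw [← mul_assoc, hb, ha]
  inv_mem' {a} ha m := by rw [← ha (m * a⁻¹), inv_mul_cancel_right]

namespace IsNestedHalf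

variable {N : Type} [Group N] {A : Set N} {d : N}

/-- Induction on the number of translates that separate `1` from `n`. If the one described by `m`
does, write `n = m⁻¹ * d * (d⁻¹ * m * n)`: the middle factor crosses that translate, and by
nestedness the outer ones cross fewer. If none does, `n` stabilises `A`. -/
theorem mem_closure (hA : IsNestedHalf A d) (n : N) :
    n ∈ Subgroup.closure ({d} ∪ (rightStabilizer A : Set N)) := by
  induction hk : {m | ¬(m ∈ A ↔ m * n ∈ A)}.ncard using Nat.strong_induction_on generalizing n with
  | _ k ih =>
  set C := Subgroup.closure ({d} ∪ (rightStabilizer A : Set N))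
  have key : ∀ n : N, {m | ¬(m ∈ A ↔ m * n ∈ A)}.ncard = k →
      (∃ m, m ∉ A ∧ m * n ∈ A) → n ∈ C := by
    rintro n hn ⟨m, hm, hmn⟩
    have hlt : ∀ S : Set N, S ⊆ {m | ¬(m ∈ A ↔ m * n ∈ A)} → m ∉ S → S.ncard < k := by
      intro S hS hmS
      rw [← hn]
      refine Set.ncard_lt_ncard ⟨hS, fun h => hmS (h ?_)⟩ (hA.finite n)
      exact fun h => hm (h.2 hmn)
    have hmd : m * (m⁻¹ * d) ∈ A := by rw [mul_inv_cancel_left]; exact hA.mem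
    have hm1 : m * m⁻¹ ∉ A := by rw [mul_inv_cancel]; exact hA.one_notMem
    have hstep : ∀ w, w ≠ m → (w * (m⁻¹ * d) ∈ A ↔ w * m⁻¹ ∈ A) := by
      intro w hw
      rw [← mul_assoc]
      exact hA.mem_mul_iff _ fun h => hw (mul_inv_eq_one.1 h)
    have h1 : m⁻¹ ∈ C := by
      refine ih _ (hlt _ ?_ ?_) _ rfl
      · intro w hw hwn
        have hwm : w ≠ m := by
          rintro rfl
          refine hw ⟨fun h => absurd h hm, fun h => absurd h hm1⟩
        have h2 := hstep w hwm
        by_cases hw1 : w ∈ A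
        · have h3 : w * m⁻¹ ∉ A := fun h => hw ⟨fun _ => h, fun _ => hw1⟩
          exact h3 (hA.nested m w hwm.symm n (m⁻¹ * d) 1 m⁻¹ hmn (hwn.1 hw1) hmd
            (mt h2.1 h3) (by rwa [mul_one]) (by rwa [mul_one]) hm1)
        · have h3 : w * m⁻¹ ∈ A := by
            by_contra h
            exact hw ⟨fun h' => absurd h' hw1, fun h' => absurd h' h⟩
          have := hA.nested m w hwm.symm (m⁻¹ * d) n m⁻¹ 1 hmd (h2.2 h3) hmn (mt hwn.2 hw1) hm1 h3
            (by rwa [mul_one])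
          rw [mul_one] at this
          exact hw1 this
      · exact fun h => h ⟨fun h' => absurd h' hm, fun h' => absurd h' hm1⟩
    have h2 : d⁻¹ * m * n ∈ C := by
      have hinj : Function.Injective fun w : N => w * (m⁻¹ * d) := mul_left_injective _
      refine ih _ ?_ _ rfl
      -- Translating the pair `1, d⁻¹ * m * n` to `m⁻¹ * d, n` preserves the number of separating
      -- translates.
      have himg : {w | ¬(w ∈ A ↔ w * (d⁻¹ * m * n) ∈ A)} =
          (fun w : N => w * (m⁻¹ * d)) '' {w | ¬(w * (m⁻¹ * d) ∈ A ↔ w * n ∈ A)} := by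
        ext w
        constructor
        · intro hw
          refine ⟨w * (d⁻¹ * m), ?_, by group⟩
          have e1 : w * (d⁻¹ * m) * (m⁻¹ * d) = w := by group
          change ¬(w * (d⁻¹ * m) * (m⁻¹ * d) ∈ A ↔ w * (d⁻¹ * m) * n ∈ A)
          rw [e1, mul_assoc w]
          exact hw
        · rintro ⟨w, hw, rfl⟩
          have e1 : w * (m⁻¹ * d) * (d⁻¹ * m * n) = w * n := by group
          change ¬(w * (m⁻¹ * d) ∈ A ↔ w * (m⁻¹ * d) * (d⁻¹ * m * n) ∈ A)
          rw [e1]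
          exact hw
      rw [himg, Set.ncard_image_of_injective _ hinj]
      refine hlt _ ?_ ?_
      · intro w hw hwn
        have hwm : w ≠ m := by
          rintro rfl
          exact hw ⟨fun _ => hmn, fun _ => hmd⟩
        have h2 := hstep w hwm
        by_cases hw1 : w ∈ A
        · have h3 : w * (m⁻¹ * d) ∉ A := fun h => hw ⟨fun _ => hwn.1 hw1, fun _ => h⟩
          exact h3 (h2.2 (hA.nested m w hwm.symm n (m⁻¹ * d) 1 m⁻¹ hmn (hwn.1 hw1) hmd
            h3 (by rwa [mul_one]) (by rwa [mul_one]) hm1))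
        · have h3 : w * (m⁻¹ * d) ∈ A := by
            by_contra h
            exact hw ⟨fun h' => absurd h' h, fun h' => absurd (hwn.2 h') hw1⟩
          have := hA.nested m w hwm.symm (m⁻¹ * d) n m⁻¹ 1 hmd h3 hmn (mt hwn.2 hw1) hm1
            (h2.1 h3) (by rwa [mul_one])
          rw [mul_one] at this
          exact hw1 this
      · exact fun h => h ⟨fun _ => hmn, fun _ => hmd⟩
    have h3 : n = m⁻¹ * (d * (d⁻¹ * m * n)) := by group
    rw [h3]
    exact mul_mem h1 (mul_mem (Subgroup.subset_closure (Or.inl rfl)) h2)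
  by_cases h : ∃ m, ¬(m ∈ A ↔ m * n ∈ A)
  · obtain ⟨m, hm⟩ := h
    -- A crossing in the other direction is treated through `n⁻¹`, which has equally many separating
    -- translates.
    by_cases hmA : m ∈ A
    · rw [← inv_mem_iff]
      refine key n⁻¹ ?_ ⟨m * n, fun h => hm ⟨fun _ => h, fun _ => hmA⟩, by
        rwa [mul_inv_cancel_right]⟩
      rw [← hk, ← Set.ncard_image_of_injective {m | ¬(m ∈ A ↔ m * n ∈ A)}
        (mul_left_injective n)]
      congr 1
      ext w
      constructor
      · intro hw
        refine ⟨w * n⁻¹, fun h => hw ?_, by group⟩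
        rw [inv_mul_cancel_right] at h
        exact h.symm
      · rintro ⟨w, hw, rfl⟩ h
        simp only [mul_inv_cancel_right] at h
        exact hw h.symm
    · exact key n hk ⟨m, hmA, by
        by_contra h
        exact hm ⟨fun h' => absurd h' hmA, fun h' => absurd h' h⟩⟩
  · push Not at h
    exact Subgroup.subset_closure (Or.inr fun m => (h m).symm)

/-- For the translates described by `d` and `1`, the elements `d`, `1` and `d⁻¹` occupy three of the
four corners; a counterexample `m` would occupy the one that remains. -/
theorem mul_mem (hA : IsNestedHalf A d) {m : N} (hm : m ∈ A) : d * m ∈ A := by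
  have h1 := hA.one_notMem
  have hd := hA.mem
  have hd1 : d ≠ 1 := fun h => h1 (h ▸ hd)
  have hinv : d⁻¹ ∉ A := by
    have := hA.mem_mul_iff d⁻¹ (inv_ne_one.2 hd1)
    rw [inv_mul_cancel] at this
    exact mt this.2 h1
  by_contra hdm
  refine absurd (hA.nested d 1 hd1 d 1 m d⁻¹ ?_ ?_ ?_ ?_ hdm ?_ ?_) ?_
  · exact (hA.mem_mul_iff d hd1).2 hd
  · rwa [one_mul]
  · rwa [mul_one]
  · rwa [mul_one]
  · rwa [one_mul]
  · rwa [mul_inv_cancel]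
  · rwa [one_mul]

theorem pow_mul_mem (hA : IsNestedHalf A d) (k : ℕ) {m : N} (hm : m ∈ A) : d ^ k * m ∈ A := by
  induction k with
  | zero => rwa [pow_zero, one_mul]
  | succ k ih => rw [pow_succ', mul_assoc]; exact hA.mul_mem ih

/-- In the dual tree, `A` and `{n | d * n ∉ A}` lie beyond the two edges at the base vertex that
belong to the axis of `d`. A nontrivial `h` fixing the vertex takes these edges to other ones, so
what lay beyond them lands between them. Each of the four cases is a violation of nestedness. -/
theorem stabilizer_mul (hA : IsNestedHalf A d) {h : N} (hh : h ∈ rightStabilizer A) (h1 : h ≠ 1)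
    {n : N} (hn : n ∈ A ∨ d * n ∉ A) : h * n ∉ A ∧ d * (h * n) ∈ A := by
  have hone := hA.one_notMem
  have hd := hA.mem
  have hd1 : d ≠ 1 := fun h => hone (h ▸ hd)
  have hhA : h ∉ A := by have := hh 1; rw [one_mul] at this; exact mt this.1 hone
  have hiH := inv_mem hh
  have hhi : h⁻¹ ∉ A := by have := hiH 1; rw [one_mul] at this; exact mt this.1 hone
  have hhd : h * d ∉ A := mt (hA.mem_mul_iff h h1).1 hhA
  have hhid : h⁻¹ * d ∉ A := mt (hA.mem_mul_iff h⁻¹ (inv_ne_one.2 h1)).1 hhi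
  have hdh : d * h ∈ A := (hh d).2 hd
  have hdhi : d * h⁻¹ ∈ A := (hiH d).2 hd
  have hinv : d⁻¹ ∉ A := by
    have := hA.mem_mul_iff d⁻¹ (inv_ne_one.2 hd1)
    rw [inv_mul_cancel] at this
    exact mt this.2 hone
  have hndh : d * h ≠ 1 := fun e => hone (e ▸ hdh)
  have hndhi : d * h⁻¹ ≠ 1 := fun e => hone (e ▸ hdhi)
  have hdhd : d * h * d ∈ A := (hA.mem_mul_iff _ hndh).2 hdh
  have hdhid : d * h⁻¹ * d ∈ A := (hA.mem_mul_iff _ hndhi).2 hdhi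
  have hhdi : h * d⁻¹ ∉ A := by
    have hne : h * d⁻¹ ≠ 1 := fun e => by
      rw [mul_inv_eq_one] at e
      exact hhA (e ▸ hd)
    have := hA.mem_mul_iff _ hne
    rw [inv_mul_cancel_right] at this
    exact mt this.2 hhA
  have hhidi : h⁻¹ * d⁻¹ ∉ A := by
    have hne : h⁻¹ * d⁻¹ ≠ 1 := fun e => by
      rw [mul_inv_eq_one] at e
      exact hhi (e ▸ hd)
    have := hA.mem_mul_iff _ hne
    rw [inv_mul_cancel_right] at this
    exact mt this.2 hhi
  have hhn : d * h ≠ d := fun e => h1 (mul_eq_left.1 e)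
  rcases hn with hn | hn
  · constructor
    · intro hc
      have := hA.nested 1 h h1.symm n d (h⁻¹ * d) 1 (by rwa [one_mul]) hc (by rwa [one_mul]) hhd
        (by rwa [one_mul]) (by rwa [mul_inv_cancel_left]) (by rwa [one_mul])
      rw [mul_one] at this
      exact hhA this
    · by_contra hc
      rw [← mul_assoc] at hc
      have hne : d * h ≠ 1 := hndh
      have := hA.nested (d * h) 1 hne d h⁻¹ n (h⁻¹ * d⁻¹) hdhd (by rwa [one_mul])
        (by rwa [mul_inv_cancel_right]) (by rwa [one_mul]) hc (by rwa [one_mul])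
        (by
          have e : d * h * (h⁻¹ * d⁻¹) = 1 := by group
          rwa [e])
      rw [one_mul] at this
      exact hhidi this
  · constructor
    · intro hc
      have hne : h ≠ d := fun e => hhA (e ▸ hd)
      have := hA.nested h d hne (h⁻¹ * d) n 1 d⁻¹ (by rwa [mul_inv_cancel_left])
        (by rwa [← mul_assoc]) hc hn (by rwa [mul_one]) (by rwa [mul_one]) hhdi
      rw [mul_inv_cancel] at this
      exact hone this
    · by_contra hc
      rw [← mul_assoc] at hc
      have e1 : d * (h⁻¹ * d⁻¹) ∈ A := by
        rw [← mul_assoc]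
        have hne : d * h⁻¹ * d⁻¹ ≠ 1 := fun e => by
          rw [mul_inv_eq_one, mul_eq_left, inv_eq_one] at e
          exact h1 e
        have := hA.mem_mul_iff _ hne
        rw [inv_mul_cancel_right] at this
        exact this.1 hdhi
      have e2 : d * h * d⁻¹ ∈ A := by
        have hne : d * h * d⁻¹ ≠ 1 := fun e => hhn (mul_inv_eq_one.1 e)
        have := hA.mem_mul_iff _ hne
        rw [inv_mul_cancel_right] at this
        exact this.1 hdh
      refine hc (hA.nested d (d * h) hhn.symm 1 (h⁻¹ * d⁻¹) d⁻¹ n (by rwa [mul_one])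
        (by rwa [mul_one]) e1 ?_ ?_ e2 hn)
      · have e : d * h * (h⁻¹ * d⁻¹) = 1 := by group
        rwa [e]
      · rwa [mul_inv_cancel]

theorem pow_inv_mul_notMem (hA : IsNestedHalf A d) (k : ℕ) {m : N} (hm : m ∉ A) :
    (d ^ k)⁻¹ * m ∉ A := fun h => hm (by
  have := hA.pow_mul_mem k h
  rwa [mul_inv_cancel_left] at this)

/-- The two free factors: an infinite cyclic group and a subgroup `H`. -/
def factor (H : Subgroup N) : Bool → Type
  | true => Multiplicative ℤ
  | false => H

instance (H : Subgroup N) : ∀ b, Group (factor H b)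
  | true => inferInstanceAs (Group (Multiplicative ℤ))
  | false => inferInstanceAs (Group H)

/-- The homomorphism on the factors given by the image of a generator of the infinite cyclic factor
and a homomorphism on the other factor. -/
def factorHom {P : Type} [Group P] (H : Subgroup N) (t : P) (ψ : H →* P) :
    ∀ b, factor H b →* P
  | true => zpowersHom P t
  | false => ψ

-- Ping-pong between `X false`, the region between the two edges on the axis of `d` at the base
-- vertex, and `X true`, what lies beyond them. Positive powers of `d` push the former into `A`,
-- negative ones into `{n | d * n ∉ A}`; `stabilizer_mul` gives the way back.
open Pointwise in
theorem lift_injective (hA : IsNestedHalf A d) : Function.Injective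
    (Monoid.CoprodI.lift (factorHom (rightStabilizer A) d (rightStabilizer A).subtype)) := by
  let X : Bool → Set N := fun b => bif b then {n | n ∈ A ∨ d * n ∉ A} else {n | n ∉ A ∧ d * n ∈ A}
  refine Monoid.CoprodI.lift_injective_of_ping_pong _ (Or.inr ⟨true, ?_⟩) X ?_ ?_ ?_
  -- The ping-pong lemma asks for a factor with at least three elements; the infinite cyclic one
  -- serves.
  · change (3 : Cardinal) ≤ Cardinal.mk (Multiplicative ℤ)
    have : Infinite (Multiplicative ℤ) := inferInstanceAs (Infinite ℤ)
    exact (Cardinal.natCast_lt_aleph0 (n := 3)).le.trans (Cardinal.aleph0_le_mk _)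
  · rintro (_ | _)
    · exact ⟨1, hA.one_notMem, by rw [mul_one]; exact hA.mem⟩
    · exact ⟨d, Or.inl hA.mem⟩
  · have h : Disjoint (X true) (X false) := by
      rw [Set.disjoint_left]
      rintro n (hn | hn) ⟨h1, h2⟩
      · exact h1 hn
      · exact hn h2
    rintro (_ | _) (_ | _) hij
    · exact absurd rfl hij
    · exact h.symm
    · exact h
    · exact absurd rfl hij
  · rintro (_ | _) (_ | _) hij
    · exact absurd rfl hij
    · intro h h1
      rintro _ ⟨n, hn, rfl⟩
      exact hA.stabilizer_mul h.2 (fun e => h1 (Subtype.ext e)) hn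
    · intro k hk
      rintro _ ⟨n, ⟨hn1, hn2⟩, rfl⟩
      have hk' : (Multiplicative.toAdd (show Multiplicative ℤ from k)) ≠ 0 := fun e => hk e
      change d ^ (Multiplicative.toAdd (show Multiplicative ℤ from k)) * n ∈ X true
      generalize Multiplicative.toAdd (show Multiplicative ℤ from k) = z at hk'
      rcases lt_or_gt_of_ne hk' with hz | hz
      · right
        obtain ⟨j, rfl⟩ : ∃ j : ℕ, z = -((j : ℤ) + 1) := ⟨(-z - 1).toNat, by omega⟩
        have e : d * (d ^ (-((j : ℤ) + 1)) * n) = (d ^ j)⁻¹ * n := by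
          rw [← mul_assoc, ← zpow_one_add, ← zpow_natCast, ← zpow_neg]
          congr 2
          ring
        rw [e]
        exact hA.pow_inv_mul_notMem j hn1
      · left
        obtain ⟨j, rfl⟩ : ∃ j : ℕ, z = (j : ℤ) + 1 := ⟨(z - 1).toNat, by omega⟩
        rw [zpow_add_one, zpow_natCast, mul_assoc]
        exact hA.pow_mul_mem j hn2
    · exact absurd rfl hij

theorem lift_surjective (hA : IsNestedHalf A d) : Function.Surjective
    (Monoid.CoprodI.lift (factorHom (rightStabilizer A) d (rightStabilizer A).subtype)) := by
  rw [← MonoidHom.range_eq_top, eq_top_iff]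
  intro n _
  refine (Subgroup.closure_le _).2 ?_ (hA.mem_closure n)
  rintro x (rfl | hx)
  · refine ⟨Monoid.CoprodI.of (i := true)
      (show factor (rightStabilizer A) true from Multiplicative.ofAdd (1 : ℤ)), ?_⟩
    rw [Monoid.CoprodI.lift_of]
    exact zpow_one _
  · refine ⟨Monoid.CoprodI.of (i := false)
      (show factor (rightStabilizer A) false from ⟨x, hx⟩), ?_⟩
    rw [Monoid.CoprodI.lift_of]
    rfl

/-- Homomorphisms out of the group are given by homomorphisms on the stabiliser of `A` together with
arbitrary images of `d`. -/
theorem exists_extension (hA : IsNestedHalf A d) {P : Type} [Group P]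
    (ψ : rightStabilizer A →* P) (t : P) :
    ∃ Ψ : N →* P, (∀ h : rightStabilizer A, Ψ h = ψ h) ∧ Ψ d = t := by
  let e := MulEquiv.ofBijective _ ⟨hA.lift_injective, hA.lift_surjective⟩
  have he : ∀ x, e x = Monoid.CoprodI.lift
      (factorHom (rightStabilizer A) d (rightStabilizer A).subtype) x :=
    fun x => MulEquiv.ofBijective_apply _ _ x
  refine ⟨(Monoid.CoprodI.lift (factorHom (rightStabilizer A) t ψ)).comp e.symm.toMonoidHom,
    fun h => ?_, ?_⟩
  · have : e.symm (h : N) = Monoid.CoprodI.of (i := false)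
        (show factor (rightStabilizer A) false from h) := by
      rw [MulEquiv.symm_apply_eq]
      rw [he, Monoid.CoprodI.lift_of]
      rfl
    change Monoid.CoprodI.lift (factorHom (rightStabilizer A) t ψ) (e.symm h) = _
    rw [this, Monoid.CoprodI.lift_of]
    rfl
  · have : e.symm d = Monoid.CoprodI.of (i := true)
        (show factor (rightStabilizer A) true from Multiplicative.ofAdd (1 : ℤ)) := by
      rw [MulEquiv.symm_apply_eq]
      rw [he, Monoid.CoprodI.lift_of]
      exact (zpow_one _).symm
    change Monoid.CoprodI.lift (factorHom (rightStabilizer A) t ψ) (e.symm d) = _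
    rw [this, Monoid.CoprodI.lift_of]
    exact zpow_one _

end IsNestedHalf

/-! ### Residual properties -/

theorem isPGroup_pi {ι : Type*} [Finite ι] {p : ℕ} {P : ι → Type*} [∀ i, Group (P i)]
    (h : ∀ i, IsPGroup p (P i)) : IsPGroup p (∀ i, P i) := by
  intro f
  have := Fintype.ofFinite ι
  choose k hk using fun i => h i (f i)
  refine ⟨∑ i, k i, funext fun i => ?_⟩
  obtain ⟨c, hc⟩ := pow_dvd_pow p (Finset.single_le_sum (fun _ _ => Nat.zero_le _)
    (Finset.mem_univ i) : k i ≤ ∑ i, k i)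
  rw [Pi.pow_apply, hc, pow_mul, hk, one_pow, Pi.one_apply]

theorem isPGroup_wreath {p : ℕ} (hp : p.Prime) {D Q : Type*} [Group D] [Group Q] [Finite D]
    [Finite Q] (hD : IsPGroup p D) (hQ : IsPGroup p Q) : IsPGroup p (RegularWreathProduct D Q) := by
  have : Fact p.Prime := ⟨hp⟩
  obtain ⟨a, ha⟩ := IsPGroup.iff_card.1 hD
  obtain ⟨b, hb⟩ := IsPGroup.iff_card.1 hQ
  refine IsPGroup.of_card (n := a * Nat.card Q + b) ?_
  rw [RegularWreathProduct.card, ha, pow_add, pow_mul, ← hb]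

theorem IsResiduallyP.subgroup {p : ℕ} {G : Type} [Group G] (h : IsResiduallyP p G)
    (H : Subgroup G) : IsResiduallyP p H := by
  intro g hg
  obtain ⟨P, _, _, φ, hP, -, hφ⟩ := h g fun e => hg (Subtype.ext e)
  exact ⟨(φ.comp H.subtype).range, inferInstance, inferInstance, (φ.comp H.subtype).rangeRestrict,
    hP.to_subgroup _, MonoidHom.rangeRestrict_surjective _, fun e => hφ (congrArg Subtype.val e)⟩

theorem IsResiduallyP.exists_hom {p : ℕ} {G : Type} [Group G] (h : IsResiduallyP p G) {T : Set G}
    (hT : T.Finite) (h1 : ∀ g ∈ T, g ≠ 1) : ∃ (P : Type) (_ : Group P) (_ : Finite P) (φ : G →* P),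
      IsPGroup p P ∧ ∀ g ∈ T, φ g ≠ 1 := by
  choose P hG hF φ hP _ hφ using fun t : T => h t.1 (h1 _ t.2)
  have : Finite T := hT
  exact ⟨∀ t, P t, inferInstance, inferInstance, MonoidHom.pi φ, isPGroup_pi hP,
    fun g hg e => hφ ⟨g, hg⟩ (congrFun e ⟨g, hg⟩)⟩

/-! ### Separation from an infinite cyclic free factor -/

/-- The product of the conjugates `x * d ^ a * x⁻¹` over a list of pairs `(x, a)`. -/
def conjWord {N : Type} [Group N] (d : N) {H : Subgroup N} (l : List (H × ℤ)) : N :=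
  (l.map fun x => (x.1 : N) * d ^ x.2 * (x.1 : N)⁻¹).prod

theorem conjWord_cons {N : Type} [Group N] (d : N) {H : Subgroup N} (x : H × ℤ)
    (l : List (H × ℤ)) :
    conjWord d (x :: l) = (x.1 : N) * d ^ x.2 * (x.1 : N)⁻¹ * conjWord d l := by
  simp [conjWord]

theorem conjWord_map_mul {N : Type} [Group N] (d : N) {H : Subgroup N} (h : H)
    (l : List (H × ℤ)) :
    conjWord d (l.map fun x => (h * x.1, x.2)) = h * conjWord d l * (h : N)⁻¹ := by
  induction l with
  | nil => simp [conjWord]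
  | cons x l ih =>
    rw [List.map_cons, conjWord_cons, conjWord_cons, ih]
    push_cast
    group

/-- Collecting the letters from `H` on the right leaves conjugates of powers of `d`; the remainder
`y` is what a retraction onto `H` killing `d` sees. -/
theorem exists_conjWord_mul {N : Type} [Group N] {d : N} {H : Subgroup N}
    (hgen : ∀ n, n ∈ Subgroup.closure ({d} ∪ (H : Set N))) (n : N) :
    ∃ (l : List (H × ℤ)) (y : H), n = conjWord d l * y := by
  refine Subgroup.closure_induction_left
    (p := fun n _ => ∃ (l : List (H × ℤ)) (y : H), n = conjWord d l * y) ?_ ?_ ?_ (hgen n)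
  · exact ⟨[], 1, by simp [conjWord]⟩
  · rintro x (rfl | hx) _ _ ⟨l, y, rfl⟩
    · exact ⟨(1, 1) :: l, y, by rw [conjWord_cons]; simp [mul_assoc]⟩
    · refine ⟨l.map fun z => (⟨x, hx⟩ * z.1, z.2), ⟨x, hx⟩ * y, ?_⟩
      rw [conjWord_map_mul]
      push_cast
      group
  · rintro x (rfl | hx) _ _ ⟨l, y, rfl⟩
    · exact ⟨(1, -1) :: l, y, by rw [conjWord_cons]; simp [mul_assoc]⟩
    · refine ⟨l.map fun z => (⟨x, hx⟩⁻¹ * z.1, z.2), ⟨x, hx⟩⁻¹ * y, ?_⟩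
      rw [conjWord_map_mul]
      push_cast
      group

theorem isConj_conjWord_rotate {N : Type} [Group N] (d : N) {H : Subgroup N} (l : List (H × ℤ))
    (i : ℕ) : IsConj (conjWord d l) (conjWord d (l.rotate i)) := by
  have key : ∀ a b : N, IsConj (a * b) (b * a) := fun a b => isConj_iff.2 ⟨a⁻¹, by group⟩
  rw [← List.rotate_mod]
  rcases l.length.eq_zero_or_pos with h | h
  · rw [List.length_eq_zero_iff.1 h, List.rotate_nil]
  · rw [List.rotate_eq_drop_append_take (Nat.mod_lt _ h).le]
    nth_rewrite 1 [← List.take_append_drop (i % l.length) l]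
    rw [conjWord, conjWord, List.map_append, List.map_append, List.prod_append, List.prod_append]
    exact key _ _

/-- A product of conjugates of powers of `d` that is not conjugate to a power of `d` is conjugate to
a cyclically reduced product, here extended to a periodic sequence. -/
theorem exists_cyclicallyReduced {N : Type} [Group N] {d n : N} {H : Subgroup N}
    (l : List (H × ℤ)) (hl : IsConj n (conjWord d l)) (hn : ∀ k : ℤ, ¬IsConj n (d ^ k)) :
    ∃ (k : ℕ) (y : ℕ → H) (b : ℕ → ℤ), 0 < k ∧ (∀ i, y (k + i) = y i) ∧ (∀ i, b (k + i) = b i) ∧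
      (∀ i, b i ≠ 0) ∧ (∀ i, y i ≠ y (i + 1)) ∧
      IsConj n ((List.range k).map fun i => (y i : N) * d ^ b i * (y i : N)⁻¹).prod := by
  induction hk : l.length using Nat.strong_induction_on generalizing l with
  | _ k ih =>
  have h0 : l ≠ [] := by
    rintro rfl
    exact hn 0 (by simpa [conjWord] using hl)
  have hk0 : 0 < k := hk ▸ List.length_pos_iff.2 h0
  have hrot : ∀ i, IsConj n (conjWord d (l.rotate i)) := fun i =>
    hl.trans (isConj_conjWord_rotate d l i)
  -- Rotation is conjugation and brings any cyclic position to the front, where a zero exponent is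
  -- dropped or equal neighbours are merged, shortening the word.
  by_cases hb : ∃ i x m, l.rotate i = (x, 0) :: m
  · obtain ⟨i, x, m, hm⟩ := hb
    refine ih m.length ?_ m ?_ rfl
    · have := congrArg List.length hm
      rw [List.length_rotate, List.length_cons] at this
      omega
    · have := hrot i
      rw [hm, conjWord_cons] at this
      simpa using this
  by_cases hy : ∃ i x a b m, l.rotate i = (x, a) :: (x, b) :: m
  · obtain ⟨i, x, a, b, m, hm⟩ := hy
    refine ih (m.length + 1) ?_ ((x, a + b) :: m) ?_ rfl
    · have := congrArg List.length hm
      rw [List.length_rotate, List.length_cons, List.length_cons] at this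
      omega
    · have := hrot i
      rw [hm, conjWord_cons, conjWord_cons] at this
      rw [conjWord_cons, zpow_add]
      convert this using 1
      group
  have hk1 : k ≠ 1 := by
    intro e
    rw [e, List.length_eq_one_iff] at hk
    obtain ⟨⟨x, a⟩, rfl⟩ := hk
    refine hn a (hl.trans ?_)
    rw [isConj_iff]
    exact ⟨(x : N)⁻¹, by simp [conjWord]; group⟩
  push Not at hb hy
  have hlt : ∀ i, i % k < l.length := fun i => by rw [hk]; exact Nat.mod_lt i hk0
  refine ⟨k, fun i => (l[i % k]'(hlt i)).1, fun i => (l[i % k]'(hlt i)).2, hk0, ?_, ?_, ?_, ?_, ?_⟩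
  · intro i; simp
  · intro i; simp
  · intro i hi
    have hhead : ∃ m, l.rotate i = l[i % k]'(hlt i) :: m := by
      rcases h : l.rotate i with _ | ⟨z, m⟩
      · rw [List.rotate_eq_nil_iff] at h
        exact absurd h h0
      · have := List.getElem_rotate l i 0 (by rw [h]; simp)
        simp only [h, List.getElem_cons_zero, zero_add, hk] at this
        exact ⟨m, by rw [this]⟩
    obtain ⟨m, hm⟩ := hhead
    exact hb i _ m (hm.trans (by rw [← hi]))
  · intro i hi
    have hhead : ∃ m, l.rotate i = l[i % k]'(hlt i) :: l[(i + 1) % k]'(hlt (i + 1)) :: m := by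
      have hlen : (l.rotate i).length = k := by rw [List.length_rotate, hk]
      rcases h : l.rotate i with _ | ⟨z, _ | ⟨w, m⟩⟩
      · rw [List.rotate_eq_nil_iff] at h
        exact absurd h h0
      · rw [h] at hlen
        exact absurd hlen.symm hk1
      · have e0 := List.getElem_rotate l i 0 (by rw [h]; simp)
        have e1 := List.getElem_rotate l i 1 (by rw [h]; simp)
        simp only [h, List.getElem_cons_zero, List.getElem_cons_succ, zero_add, hk] at e0 e1
        refine ⟨m, ?_⟩
        simp only [e0, e1, add_comm]
    obtain ⟨m, hm⟩ := hhead
    refine hy i (l[i % k]'(hlt i)).1 (l[i % k]'(hlt i)).2 (l[(i + 1) % k]'(hlt (i + 1))).2 m ?_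
    rw [hm]
    congr 2
    exact Prod.ext hi.symm rfl
  · convert hl using 1
    rw [conjWord]
    congr 1
    refine List.ext_getElem (by simp [hk]) fun i h1 h2 => ?_
    have hik : i < k := by simpa using h1
    simp [Nat.mod_eq_of_lt hik]

/-- The element of a wreath product that generates a cyclic group of functions. -/
def wreathBase {D Q : Type} [Group D] [Group Q] (u : Q → D) : RegularWreathProduct D Q :=
  ⟨fun s => u s⁻¹, 1⟩

theorem wreathBase_zpow {D Q : Type} [Group D] [Group Q] (u : Q → D) (a : ℤ) :
    wreathBase u ^ a = wreathBase fun s => u s ^ a := by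
  induction a with
  | zero => ext <;> simp [wreathBase]
  | succ a ih => rw [zpow_add_one, ih]; ext <;> simp [wreathBase, zpow_add_one]
  | pred a ih => rw [zpow_sub_one, ih]; ext <;> simp [wreathBase, zpow_sub_one]

theorem wreath_prod {D Q : Type} [Group D] [Group Q] (u : Q → D) (s : ℕ → Q) (b : ℕ → ℤ) (j : ℕ) :
    ((List.range j).map fun i => RegularWreathProduct.inl (s i) * wreathBase u ^ b i *
      (RegularWreathProduct.inl (s i))⁻¹).prod.right = 1 ∧
    ((List.range j).map fun i => RegularWreathProduct.inl (s i) * wreathBase u ^ b i *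
      (RegularWreathProduct.inl (s i))⁻¹).prod.left 1 =
      ((List.range j).map fun i => u (s i) ^ b i).prod := by
  induction j with
  | zero => simp
  | succ j ih =>
    simp only [List.range_succ, List.map_append, List.prod_append, List.map_cons, List.map_nil,
      List.prod_cons, List.prod_nil, mul_one]
    refine ⟨?_, ?_⟩
    · rw [RegularWreathProduct.mul_right, ih.1, wreathBase_zpow]
      simp [wreathBase]
    · rw [RegularWreathProduct.mul_left, Pi.mul_apply, ih.2, ih.1, wreathBase_zpow]
      simp [wreathBase]

/-- For a conjugator `c`, the coordinate at `c.right` of `c * w = wreathBase u ^ m * c` involves `w`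
only through `w.left 1`. -/
theorem exists_isConj_of_wreath {D Q : Type} [Group D] [Group Q] {u : Q → D} {m : ℤ}
    {w : RegularWreathProduct D Q} (hw : IsConj w (wreathBase u ^ m)) :
    ∃ s, IsConj (w.left 1) (u s ^ m) := by
  obtain ⟨c, hc⟩ := isConj_iff.1 hw
  rw [mul_inv_eq_iff_eq_mul, wreathBase_zpow] at hc
  have h := congrFun (congrArg RegularWreathProduct.left hc) c.right
  simp only [RegularWreathProduct.mul_left, Pi.mul_apply, inv_mul_cancel, wreathBase, inv_one,
    one_mul] at h
  exact ⟨c.right⁻¹, isConj_iff.2 ⟨c.left c.right, by rw [h, mul_inv_cancel_right]⟩⟩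

theorem one_add_mul_one_sub {R : Type*} [Ring R] {x : R} (hx : x * x = 0) :
    (1 + x) * (1 - x) = 1 := by
  have : (1 + x) * (1 - x) = 1 - x * x := by noncomm_ring
  rw [this, hx, sub_zero]

theorem one_sub_mul_one_add {R : Type*} [Ring R] {x : R} (hx : x * x = 0) :
    (1 - x) * (1 + x) = 1 := by
  have : (1 - x) * (1 + x) = 1 - x * x := by noncomm_ring
  rw [this, hx, sub_zero]

theorem sub_one_mul_sub_one {R : Type*} [Ring R] (x : R) :
    (x - 1) * (x - 1) = x * x - x - x + 1 := by
  noncomm_ring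

theorem exists_hom_of_freeSplitting {p : ℕ} (hp : p.Prime) {N : Type} [Group N] {d : N}
    {H : Subgroup N} (hgen : ∀ n, n ∈ Subgroup.closure ({d} ∪ (H : Set N)))
    (hext : ∀ (P : Type) [Group P] (ψ : H →* P) (t : P),
      ∃ Ψ : N →* P, (∀ h : H, Ψ h = ψ h) ∧ Ψ d = t)
    (hres : IsResiduallyP p H) (n : N) (hn : ∀ k : ℤ, ¬IsConj n (d ^ k)) :
    ∃ (P : Type) (_ : Group P) (_ : Finite P) (φ : N →* P),
      IsPGroup p P ∧ ∀ k : ℤ, ¬IsConj (φ n) (φ d ^ k) := by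
  classical
  -- The retraction onto `H` that kills `d`; if it does not kill `n`, a quotient of `H` already
  -- separates.
  obtain ⟨r, hrH, hrd⟩ := hext H (MonoidHom.id H) 1
  by_cases hr : r n = 1
  swap
  · obtain ⟨P, _, _, φ, hP, -, hφ⟩ := hres _ hr
    refine ⟨P, inferInstance, inferInstance, φ.comp r, hP, fun k hk => hφ ?_⟩
    rw [MonoidHom.comp_apply, MonoidHom.comp_apply, hrd, map_one, one_zpow] at hk
    exact isConj_one_left.1 hk
  obtain ⟨l, z, hl⟩ := exists_conjWord_mul hgen n
  have hz : z = 1 := by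
    rw [hl, map_mul, hrH] at hr
    have : r (conjWord d l) = 1 := by
      rw [conjWord, map_list_prod, List.map_map]
      refine List.prod_eq_one fun x hx => ?_
      obtain ⟨w, -, rfl⟩ := List.mem_map.1 hx
      simp [hrd]
    rwa [this, one_mul] at hr
  rw [hz, Subgroup.coe_one, mul_one] at hl
  obtain ⟨k, y, b, hk0, hyk, hbk, hb, hy, hc⟩ :=
    exists_cyclicallyReduced l (hl ▸ IsConj.refl n) hn
  obtain ⟨Q, _, _, q, hQ, hq⟩ := hres.exists_hom (T := Set.range fun i : Fin k =>
    y i * (y (i + 1))⁻¹) (Set.finite_range _) (by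
      rintro _ ⟨i, rfl⟩ e
      exact hy i (mul_inv_eq_one.1 e))
  have hper : ∀ i, y (i % k) = y i := by
    intro i
    induction i using Nat.strong_induction_on with
    | _ i ih =>
    rcases lt_or_ge i k with h | h
    · rw [Nat.mod_eq_of_lt h]
    · obtain ⟨j, rfl⟩ := Nat.exists_eq_add_of_le h
      rw [Nat.add_mod_left, hyk, ih j (by omega)]
  have hqy : ∀ i, q (y i) ≠ q (y (i + 1)) := by
    intro i e
    refine hq _ ⟨⟨i % k, Nat.mod_lt _ hk0⟩, rfl⟩ ?_
    have h2 : y (i % k + 1) = y (i + 1) := by rw [← hper, Nat.mod_add_mod, hper]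
    simp only [map_mul, map_inv, hper, h2, e, mul_inv_cancel]
  set Y : ℕ → Q := fun i => q (y i) with hY
  -- This makes `p ^ E` exceed the absolute value of the product, which is therefore nonzero modulo
  -- `p ^ E`.
  set E := (∏ i ∈ Finset.range (k + k), b i).natAbs with hE
  have hb0 : ∏ i ∈ Finset.range (k + k), b i ≠ 0 := Finset.prod_ne_zero_iff.2 fun i _ => hb i
  let R := ZMod (p ^ E)
  have hbR : ∏ i ∈ Finset.range (k + k), (b i : R) ≠ 0 := by
    rw [← Int.cast_prod]
    intro e
    rw [ZMod.intCast_zmod_eq_zero_iff_dvd, Int.natCast_dvd] at e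
    exact absurd (Nat.le_of_dvd (Int.natAbs_pos.2 hb0) e) (not_le.2 (Nat.lt_pow_self hp.one_lt))
  -- Two periods of the word are used: `M * M` reaches the last column, while `M` alone stops at
  -- column `k`.
  let X := stepMatrix R Y (k + k)
  have hX : ∀ s, X s * X s = 0 := fun s => stepMatrix_sq R Y _ s hqy
  let u : Q → unitriangular p E (k + k + 1) hp := fun s =>
    ⟨⟨1 + X s, 1 - X s, one_add_mul_one_sub (hX s), one_sub_mul_one_add (hX s)⟩, by
      change IsStrictlyUpper (1 + X s - 1)
      rw [add_sub_cancel_left]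
      exact isStrictlyUpper_stepMatrix R Y _ s⟩
  have hu : ∀ s (a : ℤ), ((u s ^ a : unitriangular p E (k + k + 1) hp) :
      (Matrix (Fin (k + k + 1)) (Fin (k + k + 1)) R)ˣ).val = 1 + (a : Matrix _ _ R) * X s := by
    intro s a
    exact zpow_unit_of_sq_zero (hX s) (u s).1 rfl a
  have := finite_unitriangular p E (k + k + 1) hp
  obtain ⟨Ψ, hΨH, hΨd⟩ := hext _ (RegularWreathProduct.inl.comp q) (wreathBase u)
  refine ⟨_, inferInstance, inferInstance, Ψ,
    isPGroup_wreath hp (isPGroup_unitriangular p E _ hp) hQ, fun m hm => ?_⟩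
  have hm2 := (MonoidHom.map_isConj Ψ hc).symm.trans hm
  rw [hΨd, map_list_prod, List.map_map] at hm2
  obtain ⟨s, hs⟩ := exists_isConj_of_wreath hm2
  have hw := (wreath_prod u Y b k).2
  have hfun : (⇑Ψ ∘ fun i => (y i : N) * d ^ b i * (y i : N)⁻¹) = fun i =>
      RegularWreathProduct.inl (Y i) * wreathBase u ^ b i * (RegularWreathProduct.inl (Y i))⁻¹ := by
    funext i
    simp only [Function.comp, map_mul, map_inv, map_zpow, hΨH, hΨd, MonoidHom.comp_apply, hY]
  rw [hfun, hw] at hs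
  obtain ⟨c, hcc⟩ := isConj_iff.1 hs
  rw [mul_inv_eq_iff_eq_mul] at hcc
  have hcl2 := congrArg (fun v : unitriangular p E (k + k + 1) hp => v.1.val) hcc
  set C := (c : (Matrix (Fin (k + k + 1)) (Fin (k + k + 1)) R)ˣ)
  set M := ((List.range k).map fun i => 1 + (b i : Matrix _ _ R) * X (Y i)).prod with hM
  have hval : ((((List.range k).map fun i => u (Y i) ^ b i).prod :
      unitriangular p E (k + k + 1) hp) :
      (Matrix (Fin (k + k + 1)) (Fin (k + k + 1)) R)ˣ).val = M := by
    refine (map_list_prod ((Units.coeHom _).comp (Subgroup.subtype _)) _).trans ?_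
    rw [List.map_map, hM]
    congr 2
    funext i
    exact hu _ _
  simp only [Subgroup.coe_mul, Units.val_mul, hval, hu] at hcl2
  set Z := (m : Matrix (Fin (k + k + 1)) (Fin (k + k + 1)) R) * X s with hZ
  have hZZ : Z * Z = 0 := by
    rw [hZ, mul_assoc, ← mul_assoc (X _), (Int.cast_commute m (X s)).symm.eq, mul_assoc, hX]
    simp
  have hCM : C.val * (M - 1) = Z * C.val := by
    rw [mul_sub, hcl2, mul_one, add_mul, one_mul, add_sub_cancel_left]
  -- `M` is conjugate to `1 + Z` with `Z * Z = 0`. The corner entry of this equation will be the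
  -- nonzero product of the exponents.
  have hMM : (M - 1) * (M - 1) = 0 := by
    have : C.val * ((M - 1) * (M - 1)) = 0 := by
      rw [← mul_assoc, hCM, mul_assoc, hCM, ← mul_assoc, hZZ, zero_mul]
    exact (Units.mul_right_eq_zero C).1 this
  have hMM2 : M * M = ((List.range (k + k)).map fun i => 1 + (b i : Matrix _ _ R) * X (Y i)).prod := by
    rw [List.range_add, List.map_append, List.prod_append, List.map_map]
    refine congrArg (M * List.prod ·) (List.map_congr_left fun i _ => ?_)
    simp [hY, hyk, hbk]
  have hentry := congrFun (congrFun hMM 0) (Fin.last (k + k))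
  have hexp : (M - 1) * (M - 1) = M * M - M - M + 1 := sub_one_mul_sub_one M
  have hlast : (0 : Fin (k + k + 1)) ≠ Fin.last (k + k) := by
    intro e
    have := congrArg Fin.val e
    simp at this
    omega
  rw [hexp, Matrix.add_apply, Matrix.sub_apply, Matrix.sub_apply, hMM2,
    (prod_stepMatrix_apply Y b (k + k) (k + k)).2 _ (Fin.val_last _), hM,
    (prod_stepMatrix_apply Y b (k + k) k).1 _ (by simp; omega), Matrix.one_apply_ne hlast,
    sub_zero, sub_zero, add_zero] at hentry
  exact hbR hentry

/-! ### Passing from a normal subgroup of `p`-power index to the whole group -/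

theorem IsNestedHalf.exists_hom {p : ℕ} (hp : p.Prime) {N : Type} [Group N] {A : Set N} {d : N}
    (hA : IsNestedHalf A d) (hres : IsResiduallyP p N) (n : N) (hn : ∀ k : ℤ, ¬IsConj n (d ^ k)) :
    ∃ (P : Type) (_ : Group P) (_ : Finite P) (φ : N →* P),
      IsPGroup p P ∧ ∀ k : ℤ, ¬IsConj (φ n) (φ d ^ k) :=
  exists_hom_of_freeSplitting hp hA.mem_closure (fun _ _ => hA.exists_extension)
    (hres.subgroup _) n hn

theorem exists_surjective_hom {p : ℕ} {G P : Type} [Group G] [Group P] [Finite P] {S : Set G}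
    {g : G} (φ : G →* P) (hP : IsPGroup p P) (h : ∀ s ∈ S, ¬IsConj (φ g) (φ s)) :
    ∃ (P : Type) (_ : Group P) (_ : Finite P) (φ : G →* P),
      IsPGroup p P ∧ Function.Surjective φ ∧ ∀ s ∈ S, ¬IsConj (φ g) (φ s) :=
  ⟨φ.range, inferInstance, inferInstance, φ.rangeRestrict, hP.to_subgroup _,
    MonoidHom.rangeRestrict_surjective _, fun s hs hc => h s hs (MonoidHom.map_isConj φ.range.subtype hc)⟩

/-- If `g` became conjugate to `d ^ k`, then `d ^ (k * p ^ a)` would die in a quotient where `d` has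
order beyond `p ^ (a + c)`. This forces `p ^ c ∣ k`, so `d ^ k` dies in the quotient of order `p ^
c` in which `g` survives. -/
theorem exists_hom_of_pow_eq_one {p : ℕ} (hp : p.Prime) {G : Type} [Group G]
    (hres : IsResiduallyP p G) {d g : G} (hd : ¬IsOfFinOrder d) (hg : g ≠ 1) {a : ℕ}
    (hga : g ^ p ^ a = 1) : ∃ (P : Type) (_ : Group P) (_ : Finite P) (φ : G →* P),
      IsPGroup p P ∧ ∀ k : ℤ, ¬IsConj (φ g) (φ d ^ k) := by
  have : Fact p.Prime := ⟨hp⟩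
  obtain ⟨Q₁, _, _, q₁, hQ₁, -, hq₁⟩ := hres g hg
  obtain ⟨c, hc⟩ := IsPGroup.iff_card.1 hQ₁
  have hdc : d ^ p ^ (a + c) ≠ 1 := fun h =>
    hd (isOfFinOrder_iff_pow_eq_one.2 ⟨_, Nat.pow_pos hp.pos, h⟩)
  obtain ⟨Q₂, _, _, q₂, hQ₂, -, hq₂⟩ := hres _ hdc
  refine ⟨Q₁ × Q₂, inferInstance, inferInstance, q₁.prod q₂, ?_, fun k hk => hq₁ ?_⟩
  · obtain ⟨b, hb⟩ := IsPGroup.iff_card.1 hQ₂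
    exact IsPGroup.of_card (n := c + b) (by rw [Nat.card_prod, hc, hb, pow_add])
  have h1 : IsConj (q₁ g) (q₁ d ^ k) := MonoidHom.map_isConj (MonoidHom.fst Q₁ Q₂) hk
  have h2 : IsConj (q₂ g) (q₂ d ^ k) := MonoidHom.map_isConj (MonoidHom.snd Q₁ Q₂) hk
  have h3 : q₂ d ^ (k * (p ^ a : ℕ)) = 1 := by
    rw [zpow_mul, zpow_natCast]
    have := h2.pow (p ^ a)
    rw [← map_pow, hga, map_one] at this
    exact isConj_one_right.1 this
  obtain ⟨e, he⟩ := (IsPGroup.iff_orderOf.1 hQ₂) (q₂ d)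
  have hlt : a + c < e := by
    by_contra! h
    apply hq₂
    rw [map_pow]
    exact orderOf_dvd_iff_pow_eq_one.1 (he ▸ pow_dvd_pow p h)
  have hdvd : ((p ^ c : ℕ) : ℤ) ∣ k := by
    have h4 : ((p ^ e : ℕ) : ℤ) ∣ k * (p ^ a : ℕ) := he ▸ orderOf_dvd_iff_zpow_eq_one.2 h3
    have h5 : ((p ^ c : ℕ) : ℤ) * (p ^ a : ℕ) ∣ k * (p ^ a : ℕ) := by
      refine dvd_trans ?_ h4
      rw [← Nat.cast_mul, ← pow_add]
      exact Int.natCast_dvd_natCast.2 (pow_dvd_pow p (by omega))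
    exact Int.dvd_of_mul_dvd_mul_right
      (by exact_mod_cast (Nat.pow_pos hp.pos).ne') h5
  obtain ⟨j, rfl⟩ := hdvd
  rw [zpow_mul, zpow_natCast, ← hc, pow_card_eq_one', one_zpow] at h1
  exact isConj_one_left.1 h1

/-- A homomorphism from a normal subgroup of `p`-power index to a finite `p`-group is dominated by a
homomorphism from the whole group to a finite `p`-group. -/
theorem exists_hom_of_normal {p : ℕ} (hp : p.Prime) {G Q P : Type} [Group G] [Group Q] [Group P]
    [Finite Q] [Finite P] (hQ : IsPGroup p Q) (hP : IsPGroup p P) (q : G →* Q) (φ : q.ker →* P) :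
    ∃ (P' : Type) (_ : Group P') (_ : Finite P') (Φ : G →* P'),
      IsPGroup p P' ∧ Function.Surjective Φ ∧ ∀ g, Φ g = 1 → ∃ h : g ∈ q.ker, φ ⟨g, h⟩ = 1 := by
  have : Fact p.Prime := ⟨hp⟩
  let M := φ.ker.map q.ker.subtype
  have hfin : M.FiniteIndex := by
    refine ⟨?_⟩
    rw [Subgroup.index_map_subtype]
    have h1 : φ.ker.FiniteIndex := inferInstance
    have h2 : q.ker.FiniteIndex := inferInstance
    exact mul_ne_zero h1.index_ne_zero h2.index_ne_zero
  refine ⟨G ⧸ M.normalCore, inferInstance, inferInstance, QuotientGroup.mk' _, ?_,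
    QuotientGroup.mk'_surjective _, fun g hg => ?_⟩
  · intro x
    obtain ⟨g, rfl⟩ := QuotientGroup.mk_surjective x
    obtain ⟨a, ha⟩ := hQ (q g)
    obtain ⟨b, hb⟩ := IsPGroup.iff_card.1 hP
    -- The exponent depends on `g` and on the order of `P`, but not on the conjugating element, so
    -- it serves for the normal core.
    refine ⟨a + b, ?_⟩
    rw [← QuotientGroup.mk_pow, QuotientGroup.eq_one_iff]
    intro x
    have hx : x * g ^ p ^ a * x⁻¹ ∈ q.ker := by
      rw [MonoidHom.mem_ker, map_mul, map_mul, map_pow, ha, mul_one, map_inv, mul_inv_cancel]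
    refine ⟨⟨_, hx⟩ ^ p ^ b, ?_, ?_⟩
    · change φ _ = 1
      rw [map_pow, ← hb, pow_card_eq_one']
    · rw [map_pow]
      change (x * g ^ p ^ a * x⁻¹) ^ p ^ b = _
      rw [conj_pow, ← pow_mul, ← pow_add]
  · have : g ∈ M.normalCore := (QuotientGroup.eq_one_iff g).1 hg
    obtain ⟨y, hy, rfl⟩ := Subgroup.normalCore_le M this
    exact ⟨y.2, hy⟩

theorem isConjPDistinguished_of_normal {p : ℕ} (hp : p.Prime) {G Q : Type} [Group G] [Group Q]
    [Finite Q] (hres : IsResiduallyP p G) (hQ : IsPGroup p Q) (q : G →* Q) {d : G}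
    (hd : ¬IsOfFinOrder d)
    (hcent : ∀ g, ∀ δ ∈ Subgroup.zpowers d, δ ≠ 1 → g * δ = δ * g → g ∈ Subgroup.zpowers d)
    (d' : q.ker) (hd' : ∀ n : q.ker, (n : G) ∈ Subgroup.zpowers d → ∃ k : ℤ, n = d' ^ k)
    (hd'd : (d' : G) ∈ Subgroup.zpowers d)
    (hsep : ∀ n : q.ker, (∀ k : ℤ, ¬IsConj n (d' ^ k)) →
      ∃ (P : Type) (_ : Group P) (_ : Finite P) (φ : q.ker →* P),
        IsPGroup p P ∧ ∀ k : ℤ, ¬IsConj (φ n) (φ d' ^ k)) :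
    IsConjPDistinguished p (Subgroup.zpowers d : Set G) := by
  have : Fact p.Prime := ⟨hp⟩
  intro g hg
  obtain ⟨a, ha⟩ := IsPGroup.iff_card.1 hQ
  have hpow : ∀ x : G, x ^ p ^ a ∈ q.ker := fun x => by
    rw [MonoidHom.mem_ker, map_pow, ← ha, pow_card_eq_one']
  by_cases hga : g ^ p ^ a = 1
  · have hg1 : g ≠ 1 := fun h => hg 1 (one_mem _) (h ▸ IsConj.refl _)
    obtain ⟨P, _, _, φ, hP, hφ⟩ := exists_hom_of_pow_eq_one hp hres hd hg1 hga
    refine exists_surjective_hom φ hP ?_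
    rintro _ ⟨k, rfl⟩
    simpa using hφ k
  have hconj : ∀ x : G, x⁻¹ * g ^ p ^ a * x ∈ q.ker := fun x => by
    have := hpow (x⁻¹ * g * x⁻¹⁻¹)
    rwa [conj_pow, inv_inv] at this
  -- Otherwise a conjugate of `g` has a nontrivial power in `⟨d⟩`, commutes with it, and lies in
  -- `⟨d⟩` by `hcent`.
  have hnot : ∀ (x : G) (k : ℤ), ¬IsConj (⟨_, hconj x⟩ : q.ker) (d' ^ k) := by
    intro x k hc
    obtain ⟨c, hc⟩ := isConj_iff.1 hc
    have hc' := congrArg Subtype.val hc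
    push_cast at hc'
    set y := x * (c : G)⁻¹ with hy
    have e1 : (y⁻¹ * g * y) ^ p ^ a = (d' : G) ^ k := by
      rw [← hc', hy]
      have := conj_pow (i := p ^ a) (a := y⁻¹) (b := g)
      rw [inv_inv] at this
      rw [this, hy]
      group
    have hmem : y⁻¹ * g * y ∈ Subgroup.zpowers d := by
      refine hcent _ ((d' : G) ^ k) (zpow_mem hd'd k) ?_ ?_
      · rw [← e1]
        intro h
        apply hga
        have h2 := conj_pow (i := p ^ a) (a := y⁻¹) (b := g)
        rw [inv_inv, h] at h2
        have h3 : g ^ p ^ a = y * (y⁻¹ * g ^ p ^ a * y) * y⁻¹ := by group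
        rw [h3, ← h2]
        group
      · rw [← e1]
        exact (Commute.self_pow _ _).eq
    exact hg _ hmem (isConj_iff.2 ⟨y⁻¹, by group⟩)
  have hfin : Finite (G ⧸ q.ker) := inferInstance
  -- The conjugacy class of `g ^ p ^ a` in `G` is covered by the classes in `q.ker` of its
  -- conjugates by coset representatives, so finitely many homomorphisms suffice.
  choose P hPG hPF φ hP hφ using fun c : G ⧸ q.ker => hsep ⟨_, hconj c.out⟩ (hnot c.out)
  obtain ⟨P', _, _, Φ, hP', hsurj, hΦ⟩ := exists_hom_of_normal hp hQ (isPGroup_pi hP) q (MonoidHom.pi φ)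
  refine exists_surjective_hom Φ hP' fun δ hδ hc => ?_
  obtain ⟨z, hz⟩ := isConj_iff.1 hc
  obtain ⟨y, rfl⟩ := hsurj z
  set c : G ⧸ q.ker := QuotientGroup.mk y⁻¹ with hc
  have hn : c.out⁻¹ * y⁻¹ ∈ q.ker := QuotientGroup.eq.1 (by rw [QuotientGroup.out_eq', hc])
  obtain ⟨k, hk⟩ := hd' ⟨δ ^ p ^ a, hpow δ⟩ (pow_mem hδ _)
  let n : q.ker := ⟨_, hn⟩
  -- Since `y⁻¹ = c.out * n`, this is the quotient of `y * g ^ p ^ a * y⁻¹` by `δ ^ p ^ a`, which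
  -- `Φ` kills.
  let w : q.ker := n⁻¹ * ⟨_, hconj c.out⟩ * n * (d' ^ k)⁻¹
  have hw : (w : G) = y * g ^ p ^ a * y⁻¹ * (δ ^ p ^ a)⁻¹ := by
    simp only [w, ← hk, n]
    push_cast
    group
  obtain ⟨_, hφw⟩ := hΦ w (by
    rw [hw, map_mul, map_inv, map_pow, ← hz, ← map_inv, ← map_mul, ← map_mul, ← map_pow, conj_pow,
      map_mul, map_mul, mul_inv_cancel])
  have h1 := congrFun hφw c
  change φ c w = 1 at h1
  simp only [w, map_mul, map_inv, map_zpow] at h1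
  rw [mul_inv_eq_one] at h1
  exact hφ c k (isConj_iff.2 ⟨(φ c n)⁻¹, by rw [inv_inv, h1]⟩)

/-! ### The hyperboloid model -/

/-- The Lorentzian form `(u₁ w₃ + u₃ w₁) / 2 - u₂ w₂` on `ℝ³`. -/
noncomputable def lform (u w : ℝ × ℝ × ℝ) : ℝ := (u.1 * w.2.2 + u.2.2 * w.1) / 2 - u.2.1 * w.2.1

/-- The determinant of three vectors of `ℝ³`. -/
def det3 (u v w : ℝ × ℝ × ℝ) : ℝ :=
  u.1 * (v.2.1 * w.2.2 - v.2.2 * w.2.1) - u.2.1 * (v.1 * w.2.2 - v.2.2 * w.1) +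
    u.2.2 * (v.1 * w.2.1 - v.2.1 * w.1)

/-- The determinant as a linear functional of its last argument. -/
def detForm (u v : ℝ × ℝ × ℝ) : (ℝ × ℝ × ℝ) →ₗ[ℝ] ℝ where
  toFun := det3 u v
  map_add' a b := by simp [det3]; ring
  map_smul' c a := by simp [det3]; ring

theorem lform_comm (u w : ℝ × ℝ × ℝ) : lform u w = lform w u := by simp [lform]; ring
theorem lform_add_left (u v w : ℝ × ℝ × ℝ) : lform (u + v) w = lform u w + lform v w := by
  simp [lform]; ring
theorem lform_sub_left (u v w : ℝ × ℝ × ℝ) : lform (u - v) w = lform u w - lform v w := by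
  simp [lform]; ring
theorem lform_smul_left (c : ℝ) (u w : ℝ × ℝ × ℝ) : lform (c • u) w = c * lform u w := by
  simp [lform]; ring
theorem lform_add_right (u v w : ℝ × ℝ × ℝ) : lform w (u + v) = lform w u + lform w v := by
  simp [lform]; ring
theorem lform_sub_right (u v w : ℝ × ℝ × ℝ) : lform w (u - v) = lform w u - lform w v := by
  simp [lform]; ring
theorem lform_smul_right (c : ℝ) (u w : ℝ × ℝ × ℝ) : lform w (c • u) = c * lform w u := by
  simp [lform]; ring

/-- The Gram determinant; the form has determinant `1 / 4`. Hence distances determine `det3` up to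
sign. -/
theorem det3_sq (u v w : ℝ × ℝ × ℝ) : det3 u v w ^ 2 =
    4 * (lform u u * (lform v v * lform w w - lform v w ^ 2)
      - lform u v * (lform u v * lform w w - lform v w * lform u w)
      + lform u w * (lform u v * lform v w - lform v v * lform u w)) := by
  simp only [det3, lform]; ring

namespace UpperHalfPlane

/-- The point of the hyperboloid `lform u u = 1` that corresponds to a point of the half-plane. -/
noncomputable def vec (z : UpperHalfPlane) : ℝ × ℝ × ℝ :=
  ((z.re ^ 2 + z.im ^ 2) / z.im, z.re / z.im, 1 / z.im)

theorem lform_vec (z w : UpperHalfPlane) : lform (vec z) (vec w) = Real.cosh (dist z w) := by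
  have hz := z.im_pos.ne'
  have hw := w.im_pos.ne'
  rw [cosh_dist']
  simp only [lform, vec]
  field_simp
  ring

theorem lform_vec_self (z : UpperHalfPlane) : lform (vec z) (vec z) = 1 := by
  rw [lform_vec, dist_self, Real.cosh_zero]

theorem vec_injective : Function.Injective vec := by
  intro z w h
  have h1 := lform_vec z w
  rw [h, lform_vec_self] at h1
  by_contra hne
  have := Real.one_lt_cosh.2 (dist_pos.2 hne).ne'
  linarith

theorem exists_vec_eq {u : ℝ × ℝ × ℝ} (hu : lform u u = 1) (h : 0 < u.2.2) : ∃ z, vec z = u := by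
  obtain ⟨a, b, c⟩ := u
  simp only [lform] at hu h
  refine ⟨⟨⟨b / c, 1 / c⟩, by positivity⟩, ?_⟩
  have h1 : a * c = 1 + b ^ 2 := by linarith
  have hc := h.ne'
  simp only [vec, Prod.mk.injEq]
  change (((b / c) ^ 2 + (1 / c) ^ 2) / (1 / c) = a) ∧ ((b / c) / (1 / c) = b) ∧ 1 / (1 / c) = c
  refine ⟨?_, ?_, ?_⟩
  · field_simp; linarith
  · field_simp
  · field_simp

/-- The form is negative definite on the orthogonal complement of the timelike vector `vec m`. -/
theorem eq_zero_of_lform {u : ℝ × ℝ × ℝ} (m : UpperHalfPlane) (h1 : lform u (vec m) = 0)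
    (h2 : lform u u = 0) : u = 0 := by
  obtain ⟨p, q, r⟩ := u
  have hm := lform_vec_self m
  have hc : 0 < (vec m).2.2 := one_div_pos.2 m.im_pos
  generalize vec m = w at *
  obtain ⟨a, b, c⟩ := w
  simp only [lform] at *
  have e : (p * c - r * a) ^ 2 + 4 * q ^ 2 = 0 := by
    linear_combination 4 * ((p * c + r * a) / 2 + q * b) * h1 - 4 * a * c * h2 - 4 * q ^ 2 * hm
  have hq : q = 0 := by nlinarith [sq_nonneg (p * c - r * a), sq_nonneg q]
  have hpc : p * c - r * a = 0 := by nlinarith [sq_nonneg (p * c - r * a), sq_nonneg q]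
  subst hq
  have hp : p = 0 := by
    have : p * c = 0 := by linarith
    exact (mul_eq_zero.1 this).resolve_right hc.ne'
  subst hp
  have ha : a ≠ 0 := by rintro rfl; linarith [mul_self_nonneg b]
  have hr : r = 0 := by
    have : r * a = 0 := by linarith
    exact (mul_eq_zero.1 this).resolve_right ha
  subst hr
  rfl

/-- Unit vectors on opposite sheets of the hyperboloid pair negatively, by the reversed
Cauchy-Schwarz inequality. -/
theorem pos_of_lform_pos {u : ℝ × ℝ × ℝ} (m : UpperHalfPlane) (hu : lform u u = 1)
    (h : 0 < lform u (vec m)) : 0 < u.2.2 := by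
  obtain ⟨p, q, r⟩ := u
  have hm := lform_vec_self m
  have hc : 0 < (vec m).2.2 := one_div_pos.2 m.im_pos
  generalize vec m = w at *
  obtain ⟨a, b, c⟩ := w
  simp only [lform] at *
  by_contra! hr
  have ha : 0 < a := by
    by_contra! ha
    linarith [mul_nonneg (neg_nonneg.2 ha) hc.le, mul_self_nonneg b]
  have hp : p ≤ 0 := by
    by_contra! hp
    linarith [mul_nonneg hp.le (neg_nonneg.2 hr), mul_self_nonneg q]
  have h1 : 0 ≤ -(p * c) := by nlinarith
  have h2 : 0 ≤ -(r * a) := by nlinarith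
  have h3 : (q * b) ^ 2 < ((-(p * c) + -(r * a)) / 2) ^ 2 := by
    have : ((-(p * c) + -(r * a)) / 2) ^ 2 - (q * b) ^ 2 =
        ((p * c - r * a) / 2) ^ 2 + 1 + q ^ 2 + b ^ 2 := by
      linear_combination a * c * hu + (1 + q ^ 2) * hm
    linarith [sq_nonneg ((p * c - r * a) / 2), sq_nonneg q, sq_nonneg b]
  have h4 := abs_lt_of_sq_lt_sq h3 (by linarith)
  linarith [neg_abs_le (q * b)]

/-- The relation between three collinear points of the hyperboloid. -/
theorem sinh_smul_vec {x m y : UpperHalfPlane} {p q : ℝ} (hx : Real.cosh (dist x m) = Real.cosh q)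
    (hy : Real.cosh (dist m y) = Real.cosh p) (hxy : Real.cosh (dist x y) = Real.cosh (p + q)) :
    Real.sinh (p + q) • vec m = Real.sinh p • vec x + Real.sinh q • vec y := by
  rw [← lform_vec] at hx hy hxy
  have hp := Real.cosh_sq_sub_sinh_sq p
  have hq := Real.cosh_sq_sub_sinh_sq q
  rw [← sub_eq_zero]
  apply eq_zero_of_lform m
  · simp only [lform_sub_left, lform_add_left, lform_smul_left, lform_vec_self,
      lform_comm (vec y) (vec m), hx, hy, Real.sinh_add]
    ring
  · simp only [lform_sub_left, lform_add_left, lform_smul_left, lform_sub_right, lform_add_right,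
      lform_smul_right, lform_vec_self, lform_comm (vec y) (vec m), lform_comm (vec m) (vec x),
      lform_comm (vec y) (vec x), hx, hy, hxy, Real.sinh_add, Real.cosh_add]
    linear_combination -Real.sinh p ^ 2 * hq - Real.sinh q ^ 2 * hp

theorem exists_combination {x y m : UpperHalfPlane} (h : dist x m + dist m y = dist x y) :
    ∃ a b : ℝ, 0 ≤ a ∧ 0 ≤ b ∧ vec m = a • vec x + b • vec y ∧ (m ≠ y → 0 < a) ∧
      (m ≠ x → 0 < b) := by
  by_cases hxy : x = y
  · subst hxy
    have : m = x := by
      have h1 := dist_comm x m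
      have h2 : dist m x = 0 := by rw [dist_self] at h; linarith
      exact dist_eq_zero.1 h2
    subst this
    exact ⟨1, 0, by norm_num, le_rfl, by simp, fun h => absurd rfl h, fun h => absurd rfl h⟩
  · have hs := sinh_smul_vec (x := x) (m := m) (y := y) rfl rfl (by rw [← h, add_comm])
    rw [add_comm, h] at hs
    have hd : 0 < Real.sinh (dist x y) := Real.sinh_pos_iff.2 (dist_pos.2 hxy)
    refine ⟨(Real.sinh (dist x y))⁻¹ * Real.sinh (dist m y),
      (Real.sinh (dist x y))⁻¹ * Real.sinh (dist x m), ?_, ?_, ?_, fun hm => ?_, fun hm => ?_⟩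
    · have := Real.sinh_nonneg_iff.2 (dist_nonneg (x := m) (y := y))
      positivity
    · have := Real.sinh_nonneg_iff.2 (dist_nonneg (x := x) (y := m))
      positivity
    · rw [mul_smul, mul_smul, ← smul_add, ← hs, smul_smul, inv_mul_cancel₀ hd.ne', one_smul]
    · have := Real.sinh_pos_iff.2 (dist_pos.2 hm)
      positivity
    · have := Real.sinh_pos_iff.2 (dist_pos.2 (Ne.symm hm))
      positivity

theorem dist_add_dist_of_combination {x y m : UpperHalfPlane} {a b : ℝ} (ha : 0 ≤ a) (hb : 0 ≤ b)
    (h : vec m = a • vec x + b • vec y) : dist x m + dist m y = dist x y := by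
  set C := Real.cosh (dist x y) with hC
  have h1 : Real.cosh (dist x m) = a + b * C := by
    rw [← lform_vec, h]
    simp only [lform_add_right, lform_smul_right, lform_vec_self, lform_vec]
    ring
  have h2 : Real.cosh (dist m y) = a * C + b := by
    rw [← lform_vec, h]
    simp only [lform_add_left, lform_smul_left, lform_vec_self, lform_vec]
    ring
  have h3 : a ^ 2 + b ^ 2 + 2 * a * b * C = 1 := by
    rw [← lform_vec_self m, h]
    simp only [lform_add_left, lform_smul_left, lform_add_right, lform_smul_right, lform_vec_self,
      lform_vec, dist_comm y x]
    ring
  set S := Real.sinh (dist x y) with hS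
  have hS0 : 0 ≤ S := Real.sinh_nonneg_iff.2 dist_nonneg
  have hCS : C ^ 2 - S ^ 2 = 1 := Real.cosh_sq_sub_sinh_sq _
  have h4 : Real.sinh (dist x m) = b * S := by
    refine (sq_eq_sq₀ (Real.sinh_nonneg_iff.2 dist_nonneg) (by positivity)).1 ?_
    have := Real.cosh_sq_sub_sinh_sq (dist x m)
    rw [h1] at this
    linear_combination -this + h3 + b ^ 2 * hCS
  have h5 : Real.sinh (dist m y) = a * S := by
    refine (sq_eq_sq₀ (Real.sinh_nonneg_iff.2 dist_nonneg) (by positivity)).1 ?_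
    have := Real.cosh_sq_sub_sinh_sq (dist m y)
    rw [h2] at this
    linear_combination -this + h3 + a ^ 2 * hCS
  have h6 : Real.cosh (dist x m + dist m y) = Real.cosh (dist x y) := by
    rw [Real.cosh_add, h1, h2, h4, h5, ← hC]
    linear_combination C * h3 - a * b * hCS
  have := Real.cosh_abs (dist x m + dist m y)
  exact Real.cosh_strictMonoOn.injOn (Set.mem_Ici.2 (by positivity)) (Set.mem_Ici.2 dist_nonneg) h6

theorem exists_smul_vec (x y : UpperHalfPlane) {a b : ℝ} (ha : 0 ≤ a) (hb : 0 ≤ b)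
    (hab : 0 < a + b) : ∃ m, ∃ t : ℝ, 0 < t ∧ vec m = t • (a • vec x + b • vec y) := by
  set u := a • vec x + b • vec y with hu
  have hC : 1 ≤ Real.cosh (dist x y) := Real.one_le_cosh _
  have huu : 0 < lform u u := by
    rw [hu]
    simp only [lform_add_left, lform_smul_left, lform_add_right, lform_smul_right, lform_vec_self,
      lform_vec, dist_comm y x]
    nlinarith [mul_nonneg ha hb]
  have hux : 0 < lform u (vec x) := by
    rw [hu]
    simp only [lform_add_left, lform_smul_left, lform_vec_self, lform_vec, dist_comm y x]
    nlinarith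
  have ht : 0 < (√(lform u u))⁻¹ := inv_pos.2 (Real.sqrt_pos.2 huu)
  have h1 : lform ((√(lform u u))⁻¹ • u) ((√(lform u u))⁻¹ • u) = 1 := by
    rw [lform_smul_left, lform_smul_right, ← mul_assoc, ← mul_inv, Real.mul_self_sqrt huu.le,
      inv_mul_cancel₀ huu.ne']
  obtain ⟨m, hm⟩ := exists_vec_eq h1 (pos_of_lform_pos x h1 (by
    rw [lform_smul_left]; positivity))
  exact ⟨m, _, ht, hm⟩

/-- A linear functional that changes sign along a segment vanishes at some point of it. -/
theorem exists_zero_on_segment (f : (ℝ × ℝ × ℝ) →ₗ[ℝ] ℝ) {x y : UpperHalfPlane}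
    (hx : f (vec x) ≤ 0) (hy : 0 < f (vec y)) :
    ∃ m, dist x m + dist m y = dist x y ∧ f (vec m) = 0 ∧
      ∃ a b : ℝ, 0 < a ∧ 0 ≤ b ∧ vec m = a • vec x + b • vec y := by
  -- With the weights `f (vec y)` and `-f (vec x)` the two values of `f` cancel.
  obtain ⟨m, t, ht, hm⟩ := exists_smul_vec x y (a := f (vec y)) (b := -f (vec x)) hy.le
    (by linarith) (by linarith)
  rw [smul_add, smul_smul, smul_smul] at hm
  have hb : 0 ≤ t * -f (vec x) := mul_nonneg ht.le (by linarith)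
  refine ⟨m, dist_add_dist_of_combination (mul_nonneg ht.le hy.le) hb hm, ?_, _, _,
    mul_pos ht hy, hb, hm⟩
  rw [hm, map_add, map_smul, map_smul, smul_eq_mul, smul_eq_mul]
  ring

theorem eq_zero_of_lform_of_det3 {x y : UpperHalfPlane} (hxy : x ≠ y) {w : ℝ × ℝ × ℝ}
    (hx : lform w (vec x) = 0) (hy : lform w (vec y) = 0) (hd : det3 (vec x) (vec y) w = 0) :
    w = 0 := by
  have h := det3_sq (vec x) (vec y) w
  rw [hd, lform_comm (vec x) w, lform_comm (vec y) w, hx, hy, lform_vec_self, lform_vec_self, lform_vec] at h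
  have hC := Real.one_lt_cosh.2 (dist_pos.2 hxy).ne'
  refine eq_zero_of_lform x hx ?_
  have h2 : lform w w * (1 - Real.cosh (dist x y) ^ 2) = 0 := by linarith
  exact (mul_eq_zero.1 h2).resolve_right (by nlinarith)

theorem exists_combination_of_det3 {x y : UpperHalfPlane} (hxy : x ≠ y) {w : ℝ × ℝ × ℝ}
    (hd : det3 (vec x) (vec y) w = 0) : ∃ a b : ℝ, w = a • vec x + b • vec y := by
  have hC := Real.one_lt_cosh.2 (dist_pos.2 hxy).ne'
  set C := Real.cosh (dist x y) with hCdef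
  have hC2 : C ^ 2 - 1 ≠ 0 := by nlinarith
  -- The coefficients solve the Gram system of `vec x` and `vec y`.
  refine ⟨(C * lform w (vec y) - lform w (vec x)) / (C ^ 2 - 1),
    (C * lform w (vec x) - lform w (vec y)) / (C ^ 2 - 1), ?_⟩
  rw [← sub_eq_zero]
  apply eq_zero_of_lform_of_det3 hxy
  · simp only [lform_sub_left, lform_add_left, lform_smul_left, lform_vec_self,
      lform_vec y x, dist_comm y x, ← hCdef]
    field_simp
    ring
  · simp only [lform_sub_left, lform_add_left, lform_smul_left, lform_vec_self,
      lform_vec x y, ← hCdef]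
    field_simp
    ring
  · change detForm (vec x) (vec y) _ = 0
    have hd' : detForm (vec x) (vec y) w = 0 := hd
    have h1 : detForm (vec x) (vec y) (vec x) = 0 := by simp [detForm, det3]; ring
    have h2 : detForm (vec x) (vec y) (vec y) = 0 := by simp [detForm, det3]; ring
    simp [hd', h1, h2]

end UpperHalfPlane

namespace UpperHalfPlane

/-! ### Geodesic lines and isometries -/

theorem det3_sq_eq_of_dist {x y z x' y' z' : UpperHalfPlane} (h1 : dist x y = dist x' y')
    (h2 : dist x z = dist x' z') (h3 : dist y z = dist y' z') :
    det3 (vec x) (vec y) (vec z) ^ 2 = det3 (vec x') (vec y') (vec z') ^ 2 := by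
  simp only [det3_sq, lform_vec, dist_self, h1, h2, h3]

/-- Distances to two points leave two mirror images; the determinant tells the side. -/
theorem eq_of_dist_of_det3 {x y z w : UpperHalfPlane} (hxy : x ≠ y) (hx : dist z x = dist w x)
    (hy : dist z y = dist w y)
    (hd : det3 (vec x) (vec y) (vec z) = det3 (vec x) (vec y) (vec w)) : z = w := by
  refine vec_injective (sub_eq_zero.1 (eq_zero_of_lform_of_det3 hxy ?_ ?_ ?_))
  · rw [lform_sub_left, lform_vec, lform_vec, hx, sub_self]
  · rw [lform_sub_left, lform_vec, lform_vec, hy, sub_self]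
  · change detForm (vec x) (vec y) _ = 0
    rw [map_sub, sub_eq_zero]
    exact hd

theorem _root_.Isometry.cosh_dist_line {γ : ℝ → UpperHalfPlane} (hγ : Isometry γ) (s t : ℝ) :
    Real.cosh (dist (γ s) (γ t)) = Real.cosh (t - s) := by
  rw [hγ.dist_eq, Real.dist_eq, Real.cosh_abs, ← Real.cosh_neg, neg_sub]

theorem sinh_smul_vec_line {γ : ℝ → UpperHalfPlane} (hγ : Isometry γ) (a b t : ℝ) :
    Real.sinh (b - a) • vec (γ t) =
      Real.sinh (b - t) • vec (γ a) + Real.sinh (t - a) • vec (γ b) := by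
  have := sinh_smul_vec (hγ.cosh_dist_line a t) (hγ.cosh_dist_line t b) (by
    rw [hγ.cosh_dist_line, sub_add_sub_cancel])
  rwa [sub_add_sub_cancel] at this

/-- Along a geodesic a linear functional is a combination of `cosh` and `sinh`, whence the addition
law. -/
theorem map_line_add_map_line {γ : ℝ → UpperHalfPlane} (hγ : Isometry γ)
    (f : (ℝ × ℝ × ℝ) →ₗ[ℝ] ℝ) (t c : ℝ) :
    f (vec (γ (t - c))) + f (vec (γ (t + c))) = 2 * Real.cosh c * f (vec (γ t)) := by
  by_cases hc : c = 0
  · subst hc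
    simp
    ring
  have h := congrArg f (sinh_smul_vec_line hγ (t - c) (t + c) t)
  rw [map_add, map_smul, map_smul, map_smul] at h
  have e1 : t + c - (t - c) = 2 * c := by ring
  have e2 : t + c - t = c := by ring
  have e3 : t - (t - c) = c := by ring
  rw [e1, e2, e3, Real.sinh_two_mul] at h
  simp only [smul_eq_mul] at h
  have hs : Real.sinh c ≠ 0 := by rwa [Ne, Real.sinh_eq_zero]
  refine mul_left_cancel₀ hs ?_
  linear_combination -h

/-- A linear functional that vanishes exactly on the geodesic line `γ`. -/
noncomputable def lineForm (γ : ℝ → UpperHalfPlane) : (ℝ × ℝ × ℝ) →ₗ[ℝ] ℝ :=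
  detForm (vec (γ 0)) (vec (γ 1))

theorem map_line_eq_zero {γ : ℝ → UpperHalfPlane} (hγ : Isometry γ) (f : (ℝ × ℝ × ℝ) →ₗ[ℝ] ℝ)
    {a b : ℝ} (hab : a ≠ b) (ha : f (vec (γ a)) = 0) (hb : f (vec (γ b)) = 0) (t : ℝ) :
    f (vec (γ t)) = 0 := by
  have h := congrArg f (sinh_smul_vec_line hγ a b t)
  rw [map_add, map_smul, map_smul, map_smul, ha, hb] at h
  simp only [smul_eq_mul, mul_zero, add_zero] at h
  exact (mul_eq_zero.1 h).resolve_left (by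
    rw [Real.sinh_eq_zero]; exact sub_ne_zero.2 hab.symm)

theorem detForm_left (u v : ℝ × ℝ × ℝ) : detForm u v u = 0 := by simp [detForm, det3]; ring

theorem detForm_right (u v : ℝ × ℝ × ℝ) : detForm u v v = 0 := by simp [detForm, det3]; ring

theorem lineForm_line {γ : ℝ → UpperHalfPlane} (hγ : Isometry γ) (t : ℝ) :
    lineForm γ (vec (γ t)) = 0 :=
  map_line_eq_zero hγ _ zero_ne_one (detForm_left _ _) (detForm_right _ _) t

theorem mem_range_of_lineForm {γ : ℝ → UpperHalfPlane} (hγ : Isometry γ) {z : UpperHalfPlane}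
    (hz : lineForm γ (vec z) = 0) : z ∈ Set.range γ := by
  obtain ⟨a, b, hab⟩ := exists_combination_of_det3 (hγ.injective.ne zero_ne_one) hz
  have h01 := hγ.cosh_dist_line 0 1
  rw [sub_zero] at h01
  set C := Real.cosh 1 with hC
  set S := Real.sinh 1 with hS
  have hCS : C ^ 2 - S ^ 2 = 1 := Real.cosh_sq_sub_sinh_sq 1
  have hS0 : 0 < S := Real.sinh_pos_iff.2 one_pos
  have h1 : a ^ 2 + b ^ 2 + 2 * a * b * C = 1 := by
    rw [← lform_vec_self z, hab]
    simp only [lform_add_left, lform_smul_left, lform_add_right, lform_smul_right, lform_vec_self,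
      lform_vec, dist_comm (γ 1) (γ 0), h01]
    ring
  have h2 : a + b * C = Real.cosh (dist z (γ 0)) := by
    rw [← lform_vec, hab]
    simp only [lform_add_left, lform_smul_left, lform_vec_self, lform_vec, dist_comm (γ 1) (γ 0),
      h01]
    ring
  -- The coefficient of `vec (γ 1)` in `vec (γ t)` is `sinh t / sinh 1`, which has to be `b`.
  set t := Real.arsinh (b * S) with ht
  have hst : Real.sinh t = b * S := Real.sinh_arsinh _
  have hct : Real.cosh t = a + b * C := by
    refine (sq_eq_sq₀ (Real.cosh_pos t).le (h2 ▸ (Real.cosh_pos _).le)).1 ?_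
    have := Real.cosh_sq_sub_sinh_sq t
    rw [hst] at this
    linear_combination this - h1 - b ^ 2 * hCS
  refine ⟨t, vec_injective ?_⟩
  have h := sinh_smul_vec_line hγ 0 1 t
  rw [sub_zero, sub_zero, Real.sinh_sub, hst, hct, ← hS, ← hC] at h
  have e : S * (a + b * C) - C * (b * S) = S * a := by ring
  rw [e, mul_comm b S, mul_smul, mul_smul, ← smul_add, ← hab] at h
  exact smul_right_injective _ hS0.ne' h

theorem lineForm_eq_zero_iff {γ : ℝ → UpperHalfPlane} (hγ : Isometry γ) {z : UpperHalfPlane} :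
    lineForm γ (vec z) = 0 ↔ z ∈ Set.range γ := by
  refine ⟨mem_range_of_lineForm hγ, ?_⟩
  rintro ⟨t, rfl⟩
  exact lineForm_line hγ t

theorem range_eq_of_mem {γ δ : ℝ → UpperHalfPlane} (hγ : Isometry γ) (hδ : Isometry δ)
    {a b : ℝ} (hab : a ≠ b) (ha : δ a ∈ Set.range γ) (hb : δ b ∈ Set.range γ) :
    Set.range δ = Set.range γ := by
  have hsub : Set.range δ ⊆ Set.range γ := by
    rintro _ ⟨t, rfl⟩
    rw [← lineForm_eq_zero_iff hγ] at ha hb ⊢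
    exact map_line_eq_zero hδ _ hab ha hb t
  refine hsub.antisymm ?_
  rintro _ ⟨t, rfl⟩
  have h0 := hsub ⟨0, rfl⟩
  have h1 := hsub ⟨1, rfl⟩
  obtain ⟨s₀, hs₀⟩ := h0
  obtain ⟨s₁, hs₁⟩ := h1
  refine mem_range_of_lineForm hδ (map_line_eq_zero hγ _ (a := s₀) (b := s₁) ?_ ?_ ?_ t)
  · rintro rfl
    exact zero_ne_one (hδ.injective (hs₀.symm.trans hs₁))
  · rw [hs₀]; exact detForm_left _ _
  · rw [hs₁]; exact detForm_right _ _

theorem exists_line {x y : UpperHalfPlane} (hxy : x ≠ y) :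
    ∃ γ : ℝ → UpperHalfPlane, Isometry γ ∧ γ 0 = x ∧ γ (dist x y) = y := by
  set d := dist x y with hd
  have hd0 : 0 < Real.sinh d := Real.sinh_pos_iff.2 (dist_pos.2 hxy)
  let w : ℝ → ℝ × ℝ × ℝ := fun t =>
    (Real.sinh d)⁻¹ • (Real.sinh (d - t) • vec x + Real.sinh t • vec y)
  have hxy' : lform (vec x) (vec y) = Real.cosh d := lform_vec x y
  have hyx' : lform (vec y) (vec x) = Real.cosh d := by rw [lform_comm, hxy']
  have hcs := Real.cosh_sq_sub_sinh_sq d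
  have hw : ∀ s t, lform (w s) (w t) = Real.cosh (t - s) := by
    intro s t
    simp only [w, lform_add_left, lform_smul_left, lform_add_right, lform_smul_right,
      lform_vec_self, hxy', hyx', Real.sinh_sub, Real.cosh_sub]
    have hs := Real.cosh_sq_sub_sinh_sq s
    have ht := Real.cosh_sq_sub_sinh_sq t
    field_simp
    linear_combination (-Real.sinh s * Real.sinh t) * hcs
  have hwx : ∀ t, lform (w t) (vec x) = Real.cosh t := by
    intro t
    simp only [w, lform_add_left, lform_smul_left, lform_vec_self, hyx', Real.sinh_sub]
    field_simp
    ring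
  have hex : ∀ t, ∃ z, vec z = w t := fun t =>
    exists_vec_eq (by rw [hw, sub_self, Real.cosh_zero])
      (pos_of_lform_pos x (by rw [hw, sub_self, Real.cosh_zero]) (by
        rw [hwx]; exact Real.cosh_pos t))
  choose γ hγ using hex
  refine ⟨γ, Isometry.of_dist_eq fun s t => ?_, vec_injective ?_, vec_injective ?_⟩
  · have : Real.cosh (dist (γ s) (γ t)) = Real.cosh (dist s t) := by
      rw [← lform_vec, hγ, hγ, hw, Real.dist_eq, Real.cosh_abs, ← Real.cosh_neg, neg_sub]
    exact Real.cosh_strictMonoOn.injOn (Set.mem_Ici.2 dist_nonneg) (Set.mem_Ici.2 dist_nonneg) this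
  · rw [hγ]
    simp only [w, sub_zero, Real.sinh_zero, zero_smul, add_zero]
    rw [smul_smul, inv_mul_cancel₀ hd0.ne', one_smul]
  · rw [hγ]
    simp only [w, sub_self, Real.sinh_zero, zero_smul, zero_add]
    rw [smul_smul, inv_mul_cancel₀ hd0.ne', one_smul]

theorem fixes_line {γ : ℝ → UpperHalfPlane} (hγ : Isometry γ)
    (g : UpperHalfPlane ≃ᵢ UpperHalfPlane) {a b : ℝ} (hab : a ≠ b) (ha : g (γ a) = γ a)
    (hb : g (γ b) = γ b) (t : ℝ) : g (γ t) = γ t := by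
  have hz : det3 (vec (γ a)) (vec (γ b)) (vec (γ t)) = 0 :=
    map_line_eq_zero hγ (detForm (vec (γ a)) (vec (γ b))) hab (detForm_left _ _)
      (detForm_right _ _) t
  have hza : dist (g (γ t)) (γ a) = dist (γ t) (γ a) := by
    nth_rewrite 1 [← ha]; exact g.dist_eq _ _
  have hzb : dist (g (γ t)) (γ b) = dist (γ t) (γ b) := by
    nth_rewrite 1 [← hb]; exact g.dist_eq _ _
  refine eq_of_dist_of_det3 (hγ.injective.ne hab) hza hzb ?_
  have := det3_sq_eq_of_dist (x := γ a) (y := γ b) (z := g (γ t)) (x' := γ a) (y' := γ b)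
    (z' := γ t) rfl (by rw [dist_comm, hza, dist_comm]) (by rw [dist_comm, hzb, dist_comm])
  rw [hz, zero_pow two_ne_zero, sq_eq_zero_iff] at this
  rw [hz, this]

theorem isHypReflection_of_fixed {x y : UpperHalfPlane} (hxy : x ≠ y)
    (g : UpperHalfPlane ≃ᵢ UpperHalfPlane) (hg : g ≠ 1) (hx : g x = x) (hy : g y = y) :
    IsHypReflection g := by
  obtain ⟨γ, hγ, h0, h1⟩ := exists_line hxy
  refine ⟨hg, Set.range γ, ⟨γ, hγ, rfl⟩, ?_⟩
  rintro _ ⟨t, rfl⟩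
  exact fixes_line hγ g (dist_pos.2 hxy).ne (by rw [h0, hx]) (by rw [h1, hy]) t

theorem continuous_vec : Continuous vec := by
  have h : ∀ z : UpperHalfPlane, z.im ≠ 0 := fun z => z.im_pos.ne'
  unfold vec
  have h1 : Continuous fun z : UpperHalfPlane => z.re := continuous_re
  have h2 : Continuous fun z : UpperHalfPlane => z.im := continuous_im
  exact (((h1.pow 2).add (h2.pow 2)).div h2 h).prodMk
    ((h1.div h2 h).prodMk (continuous_const.div h2 h))

/-- An isometry that exchanges `o` and `g o` fixes their midpoint. -/
theorem exists_fixed_midpoint (g : UpperHalfPlane ≃ᵢ UpperHalfPlane) (o : UpperHalfPlane)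
    (ho : g (g o) = o) :
    ∃ w, g w = w ∧ ∃ t : ℝ, 0 < t ∧ vec w = t • (vec o + vec (g o)) := by
  obtain ⟨w, t, ht, hw⟩ := exists_smul_vec o (g o) zero_le_one zero_le_one (by norm_num)
  rw [one_smul, one_smul] at hw
  refine ⟨w, ?_, t, ht, hw⟩
  have hdist : dist w o = dist w (g o) := by
    have h : Real.cosh (dist w o) = Real.cosh (dist w (g o)) := by
      rw [← lform_vec, ← lform_vec, hw]
      simp only [lform_add_left, lform_smul_left, lform_vec_self, lform_comm (vec (g o)) (vec o)]
      ring
    exact Real.cosh_strictMonoOn.injOn (Set.mem_Ici.2 dist_nonneg) (Set.mem_Ici.2 dist_nonneg) h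
  have h1 : dist (g w) (g o) = dist w (g o) := by rw [g.dist_eq, hdist]
  have h2 : dist (g w) o = dist w o := by
    nth_rewrite 1 [← ho]
    rw [g.dist_eq, hdist]
  by_cases hog : o = g o
  · have : vec w = vec o := by
      rw [← hog, ← two_smul ℝ (vec o), smul_smul] at hw
      have h3 := lform_vec_self w
      rw [hw, lform_smul_left, lform_smul_right, lform_vec_self, mul_one] at h3
      have : t * 2 = 1 := by nlinarith
      rw [hw, this, one_smul]
    rw [vec_injective this, ← hog]
  · refine eq_of_dist_of_det3 hog h2 h1 ?_
    have hz : det3 (vec o) (vec (g o)) (vec w) = 0 := by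
      change detForm (vec o) (vec (g o)) (vec w) = 0
      rw [hw, map_smul, map_add, detForm_left, detForm_right, add_zero, smul_zero]
    have := det3_sq_eq_of_dist (x := o) (y := g o) (z := g w) (x' := o) (y' := g o) (z' := w) rfl
      (by rw [dist_comm, h2, dist_comm]) (by rw [dist_comm, h1, dist_comm])
    rw [hz, zero_pow two_ne_zero, sq_eq_zero_iff] at this
    rw [hz, this]

end UpperHalfPlane

namespace HyperbolicTwoOrbifold

open UpperHalfPlane

/-! ### The boundary geodesics of the universal cover -/

variable (O : HyperbolicTwoOrbifold)

theorem mem_of_combination {x y m : UpperHalfPlane} (hx : x ∈ O.cover) (hy : y ∈ O.cover)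
    {a b : ℝ} (ha : 0 ≤ a) (hb : 0 ≤ b) (h : vec m = a • vec x + b • vec y) : m ∈ O.cover :=
  O.convex_cover x hx y hy m (dist_add_dist_of_combination ha hb h)

theorem mem_of_combination₃ {x y z m : UpperHalfPlane} (hx : x ∈ O.cover) (hy : y ∈ O.cover)
    (hz : z ∈ O.cover) {a b c : ℝ} (ha : 0 < a) (hb : 0 ≤ b) (hc : 0 ≤ c)
    (h : vec m = a • vec x + b • vec y + c • vec z) : m ∈ O.cover := by
  obtain ⟨w, t, ht, hw⟩ := exists_smul_vec x y ha.le hb (by linarith)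
  have hwm : w ∈ O.cover := by
    rw [smul_add, smul_smul, smul_smul] at hw
    exact O.mem_of_combination hx hy (by positivity) (by positivity) hw
  refine O.mem_of_combination hwm hz (inv_pos.2 ht).le hc ?_
  rw [hw, smul_smul, inv_mul_cancel₀ ht.ne', one_smul, h]

theorem frontier_subset : frontier O.cover ⊆ O.cover := O.isClosed_cover.frontier_subset

theorem cramer (u v w x : ℝ × ℝ × ℝ) : det3 u v w • x =
    det3 x v w • u + det3 u x w • v + det3 u v x • w := by
  ext <;> simp [det3] <;> ring

/-- A segment in the cover crossing `γ` would span, with two points of `γ` around the crossing, a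
quadrilateral in the cover. The crossing would then be an interior point. -/
theorem not_opposite_sides {γ : ℝ → UpperHalfPlane} (hγ : Isometry γ)
    (hfr : Set.range γ ⊆ frontier O.cover) {z w : UpperHalfPlane} (hz : z ∈ O.cover)
    (hw : w ∈ O.cover) (hfz : lineForm γ (vec z) < 0) (hfw : 0 < lineForm γ (vec w)) : False := by
  obtain ⟨m, -, hm0, a, b, ha, hb, hm⟩ := exists_zero_on_segment _ hfz.le hfw
  obtain ⟨t, rfl⟩ := mem_range_of_lineForm hγ hm0
  set x := γ (t - 1)
  set y := γ (t + 1)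
  have hx : x ∈ O.cover := O.frontier_subset (hfr ⟨_, rfl⟩)
  have hy : y ∈ O.cover := O.frontier_subset (hfr ⟨_, rfl⟩)
  have hxy : x ≠ y := hγ.injective.ne (by linarith)
  have hne : ∀ u, lineForm γ (vec u) ≠ 0 → det3 (vec x) (vec y) (vec u) ≠ 0 := by
    intro u hu h
    obtain ⟨α, β, h⟩ := exists_combination_of_det3 hxy h
    apply hu
    rw [h, map_add, map_smul, map_smul, lineForm_line hγ, lineForm_line hγ, smul_zero, smul_zero,
      add_zero]
  have hDz := hne z hfz.ne
  have hDw := hne w hfw.ne'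
  -- the midpoint `γ t` is a positive combination of `x` and `y`
  have hmid := sinh_smul_vec_line hγ (t - 1) (t + 1) t
  have e1 : t + 1 - (t - 1) = 2 := by ring
  have e2 : t + 1 - t = 1 := by ring
  have e3 : t - (t - 1) = 1 := by ring
  rw [e1, e2, e3] at hmid
  have hs1 : 0 < Real.sinh 1 := Real.sinh_pos_iff.2 one_pos
  have hs2 : 0 < Real.sinh 2 := Real.sinh_pos_iff.2 two_pos
  have hmid' : ∃ c : ℝ, 0 < c ∧ vec (γ t) = c • vec x + c • vec y := by
    refine ⟨(Real.sinh 2)⁻¹ * Real.sinh 1, by positivity, ?_⟩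
    rw [mul_smul, mul_smul, ← smul_add, ← hmid, smul_smul, inv_mul_cancel₀ hs2.ne', one_smul]
  obtain ⟨c, hc, hmc⟩ := hmid'
  have hsign : a * det3 (vec x) (vec y) (vec z) + b * det3 (vec x) (vec y) (vec w) = 0 := by
    have h1 : detForm (vec x) (vec y) (vec (γ t)) = 0 := by
      rw [hmc, map_add, map_smul, map_smul, detForm_left, detForm_right, smul_zero,
        add_zero]
    rw [hm, map_add, map_smul, map_smul] at h1
    exact h1
  have hcoef : ∀ v, det3 (vec x) (vec y) (vec v) ≠ 0 →
      ∀ᶠ u in nhds (γ t), 0 < det3 (vec u) (vec y) (vec v) / det3 (vec x) (vec y) (vec v) ∧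
        0 < det3 (vec x) (vec u) (vec v) / det3 (vec x) (vec y) (vec v) := by
    intro v hv
    have hc1 : Continuous fun u : UpperHalfPlane =>
        det3 (vec u) (vec y) (vec v) / det3 (vec x) (vec y) (vec v) := by
      refine Continuous.div_const ?_ _
      have h1 := continuous_vec.fst
      have h2 := continuous_vec.snd.fst
      have h3 := continuous_vec.snd.snd
      unfold det3
      fun_prop
    have hc2 : Continuous fun u : UpperHalfPlane =>
        det3 (vec x) (vec u) (vec v) / det3 (vec x) (vec y) (vec v) := by
      refine Continuous.div_const ?_ _
      have h1 := continuous_vec.fst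
      have h2 := continuous_vec.snd.fst
      have h3 := continuous_vec.snd.snd
      unfold det3
      fun_prop
    have h1 : det3 (vec (γ t)) (vec y) (vec v) / det3 (vec x) (vec y) (vec v) = c := by
      rw [div_eq_iff hv, hmc]
      simp [det3]
      ring
    have h2 : det3 (vec x) (vec (γ t)) (vec v) / det3 (vec x) (vec y) (vec v) = c := by
      rw [div_eq_iff hv, hmc]
      simp [det3]
      ring
    exact (hc1.continuousAt.eventually_const_lt (hc.trans_eq h1.symm)).and
      (hc2.continuousAt.eventually_const_lt (hc.trans_eq h2.symm))
  -- By Cramer's rule the three quotients are the coordinates of `u` in the basis `vec x`, `vec y`,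
  -- `vec v`.
  have hmem : ∀ v u, v ∈ O.cover → det3 (vec x) (vec y) (vec v) ≠ 0 →
      0 < det3 (vec u) (vec y) (vec v) / det3 (vec x) (vec y) (vec v) →
      0 < det3 (vec x) (vec u) (vec v) / det3 (vec x) (vec y) (vec v) →
      0 ≤ det3 (vec x) (vec y) (vec u) / det3 (vec x) (vec y) (vec v) → u ∈ O.cover := by
    intro v u hv hD h1 h2 h3
    refine O.mem_of_combination₃ hx hy hv h1 h2.le h3 ?_
    have := cramer (vec x) (vec y) (vec v) (vec u)
    rw [div_eq_inv_mul, div_eq_inv_mul, div_eq_inv_mul, mul_smul, mul_smul, mul_smul, ← smul_add,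
      ← smul_add, ← this, smul_smul, inv_mul_cancel₀ hD, one_smul]
  have hint : γ t ∈ interior O.cover := by
    rw [mem_interior_iff_mem_nhds]
    filter_upwards [hcoef z hDz, hcoef w hDw] with u hu1 hu2
    by_cases h : 0 ≤ det3 (vec x) (vec y) (vec u) / det3 (vec x) (vec y) (vec z)
    · exact hmem z u hz hDz hu1.1 hu1.2 h
    · refine hmem w u hw hDw hu2.1 hu2.2 ?_
      set δ := det3 (vec x) (vec y) (vec u)
      set Dz := det3 (vec x) (vec y) (vec z)
      set Dw := det3 (vec x) (vec y) (vec w)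
      have hb0 : b ≠ 0 := by
        rintro rfl
        rw [zero_mul, add_zero] at hsign
        exact (mul_ne_zero ha.ne' hDz) hsign
      have e : δ / Dw = -(b / a) * (δ / Dz) := by
        field_simp
        linear_combination δ * hsign
      rw [e]
      have h1 : 0 < b / a := div_pos (lt_of_le_of_ne hb hb0.symm) ha
      nlinarith
  exact (hfr ⟨t, rfl⟩).2 hint

theorem same_side {γ : ℝ → UpperHalfPlane} (hγ : Isometry γ)
    (hfr : Set.range γ ⊆ frontier O.cover) {z w : UpperHalfPlane} (hz : z ∈ O.cover)
    (hw : w ∈ O.cover) : 0 ≤ lineForm γ (vec z) * lineForm γ (vec w) := by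
  rcases lt_trichotomy (lineForm γ (vec z)) 0 with h1 | h1 | h1 <;>
  rcases lt_trichotomy (lineForm γ (vec w)) 0 with h2 | h2 | h2
  · exact (mul_pos_of_neg_of_neg h1 h2).le
  · rw [h2, mul_zero]
  · exact (O.not_opposite_sides hγ hfr hz hw h1 h2).elim
  · rw [h1, zero_mul]
  · rw [h1, zero_mul]
  · rw [h1, zero_mul]
  · exact (O.not_opposite_sides hγ hfr hw hz h2 h1).elim
  · rw [h2, mul_zero]
  · exact (mul_pos h1 h2).le

/-- If a segment in the cover meets a boundary geodesic in an inner point then its end points lie on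
the geodesic. -/
theorem mem_range_of_combination {γ : ℝ → UpperHalfPlane} (hγ : Isometry γ)
    (hfr : Set.range γ ⊆ frontier O.cover) {x y m : UpperHalfPlane} (hx : x ∈ O.cover)
    (hy : y ∈ O.cover) {a b : ℝ} (ha : 0 < a) (hb : 0 < b) (h : vec m = a • vec x + b • vec y)
    (hm : m ∈ Set.range γ) : x ∈ Set.range γ ∧ y ∈ Set.range γ := by
  rw [← lineForm_eq_zero_iff hγ, h, map_add, map_smul, map_smul, smul_eq_mul, smul_eq_mul] at hm
  have h1 := O.same_side hγ hfr hx hy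
  rw [← lineForm_eq_zero_iff hγ, ← lineForm_eq_zero_iff hγ]
  set p := lineForm γ (vec x)
  set q := lineForm γ (vec y)
  have hp : a * p ^ 2 + b * (p * q) = 0 := by linear_combination p * hm
  have hp2 : p = 0 := by
    have h2 : 0 ≤ b * (p * q) := by positivity
    have h3 : a * p ^ 2 = 0 := le_antisymm (by linarith) (by positivity)
    exact pow_eq_zero_iff two_ne_zero |>.1 ((mul_eq_zero.1 h3).resolve_left ha.ne')
  refine ⟨hp2, ?_⟩
  rw [hp2, mul_zero, zero_add] at hm
  exact (mul_eq_zero.1 hm).resolve_left hb.ne'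

/-- Boundary geodesics that meet are equal. -/
theorem range_eq_of_meet {γ δ : ℝ → UpperHalfPlane} (hγ : Isometry γ) (hδ : Isometry δ)
    (hγfr : Set.range γ ⊆ frontier O.cover) (hδfr : Set.range δ ⊆ frontier O.cover) {t : ℝ}
    (ht : δ t ∈ Set.range γ) : Set.range δ = Set.range γ := by
  have hs1 : 0 < Real.sinh 1 := Real.sinh_pos_iff.2 one_pos
  have hs2 : 0 < Real.sinh 2 := Real.sinh_pos_iff.2 two_pos
  have hmid := sinh_smul_vec_line hδ (t - 1) (t + 1) t
  have e1 : t + 1 - (t - 1) = 2 := by ring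
  have e2 : t + 1 - t = 1 := by ring
  have e3 : t - (t - 1) = 1 := by ring
  rw [e1, e2, e3] at hmid
  have h := O.mem_range_of_combination hγ hγfr (O.frontier_subset (hδfr ⟨t - 1, rfl⟩))
    (O.frontier_subset (hδfr ⟨t + 1, rfl⟩)) (a := (Real.sinh 2)⁻¹ * Real.sinh 1)
    (b := (Real.sinh 2)⁻¹ * Real.sinh 1) (m := δ t) (by positivity) (by positivity) (by
      rw [mul_smul, mul_smul, ← smul_add, ← hmid, smul_smul, inv_mul_cancel₀ hs2.ne', one_smul]) ht
  exact range_eq_of_mem hγ hδ (by linarith) h.1 h.2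

theorem exists_off_line {γ : ℝ → UpperHalfPlane} (hγ : Isometry γ)
    (hfr : Set.range γ ⊆ frontier O.cover) : ∃ o ∈ O.cover, lineForm γ (vec o) ≠ 0 := by
  obtain ⟨o, ho⟩ := O.interior_nonempty
  exact ⟨o, interior_subset ho, fun h => (hfr (mem_range_of_lineForm hγ h)).2 ho⟩

theorem map_mem_cover {g : UpperHalfPlane ≃ᵢ UpperHalfPlane} (hg : g ∈ O.pi1) {x : UpperHalfPlane}
    (hx : x ∈ O.cover) : g x ∈ O.cover := by
  rw [← O.image_cover g hg]
  exact ⟨x, hx, rfl⟩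

theorem image_frontier {g : UpperHalfPlane ≃ᵢ UpperHalfPlane} (hg : g ∈ O.pi1) :
    g '' frontier O.cover = frontier O.cover := by
  have := g.toHomeomorph.image_frontier O.cover
  change g '' _ = frontier (g '' _) at this
  rw [this, O.image_cover g hg]

theorem range_comp_subset {γ : ℝ → UpperHalfPlane} (hfr : Set.range γ ⊆ frontier O.cover)
    {g : UpperHalfPlane ≃ᵢ UpperHalfPlane} (hg : g ∈ O.pi1) :
    Set.range (g ∘ γ) ⊆ frontier O.cover := by
  rw [Set.range_comp, ← O.image_frontier hg]
  exact Set.image_mono hfr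

/-! ### The stabiliser of a boundary geodesic -/

theorem eq_one_of_fixes_line (hrefl : O.HasNoReflectors) {γ : ℝ → UpperHalfPlane}
    (hγ : Isometry γ) {g : UpperHalfPlane ≃ᵢ UpperHalfPlane} (hg : g ∈ O.pi1)
    (h : ∀ t, g (γ t) = γ t) : g = 1 := by
  by_contra h1
  refine hrefl g hg ⟨h1, Set.range γ, ⟨γ, hγ, rfl⟩, ?_⟩
  rintro _ ⟨t, rfl⟩
  exact h t

/-- `g ^ 2` fixes `γ` pointwise and keeps the side of the cover, so `g` exchanges `o` and `g o`. It
fixes their midpoint, which is off `γ`, and the centre `γ (c / 2)` of the flip; two fixed points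
make it a reflection. -/
theorem not_flip (hrefl : O.HasNoReflectors) {γ : ℝ → UpperHalfPlane} (hγ : Isometry γ)
    (hfr : Set.range γ ⊆ frontier O.cover) {g : UpperHalfPlane ≃ᵢ UpperHalfPlane} (hg : g ∈ O.pi1)
    {c : ℝ} (hc : ∀ t, g (γ t) = γ (c - t)) : False := by
  obtain ⟨o, ho, hoγ⟩ := O.exists_off_line hγ hfr
  have hg1 : g ≠ 1 := by
    rintro rfl
    have := hγ.injective (hc (c / 2 + 1))
    linarith
  have hgg : ∀ t, g (g (γ t)) = γ t := fun t => by rw [hc, hc, sub_sub_cancel]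
  have hgo := O.map_mem_cover hg ho
  have hggo := O.map_mem_cover hg hgo
  have hd : ∀ t, dist (g (g o)) (γ t) = dist o (γ t) := fun t => by
    nth_rewrite 1 [← hgg t]
    rw [g.dist_eq, g.dist_eq]
  have ho2 : g (g o) = o := by
    refine eq_of_dist_of_det3 (hγ.injective.ne zero_ne_one) (hd 0) (hd 1) ?_
    have h1 := det3_sq_eq_of_dist (x := γ 0) (y := γ 1) (z := g (g o)) (x' := γ 0) (y' := γ 1)
      (z' := o) rfl (by rw [dist_comm, hd, dist_comm]) (by rw [dist_comm, hd, dist_comm])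
    have h2 := O.same_side hγ hfr hggo ho
    change lineForm γ (vec (g (g o))) = lineForm γ (vec o)
    change lineForm γ (vec (g (g o))) ^ 2 = lineForm γ (vec o) ^ 2 at h1
    rcases sq_eq_sq_iff_eq_or_eq_neg.1 h1 with h3 | h3
    · exact h3
    · rw [h3] at h2
      have : 0 < lineForm γ (vec o) ^ 2 := by positivity
      nlinarith
  obtain ⟨w, hw, t, ht, hwv⟩ := exists_fixed_midpoint g o ho2
  have hfw : lineForm γ (vec w) ≠ 0 := by
    rw [hwv, map_smul, map_add, smul_eq_mul]
    refine mul_ne_zero ht.ne' fun h => ?_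
    have h2 := O.same_side hγ hfr ho hgo
    have h3 : lineForm γ (vec (g o)) = -lineForm γ (vec o) := by linarith
    rw [h3] at h2
    have : 0 < lineForm γ (vec o) ^ 2 := by positivity
    nlinarith
  refine hrefl g hg (isHypReflection_of_fixed (x := w) (y := γ (c / 2)) ?_ g hg1 hw ?_)
  · rintro rfl
    exact hfw (lineForm_line hγ _)
  · rw [hc]
    congr 1
    ring

theorem exists_translation (hrefl : O.HasNoReflectors) {γ : ℝ → UpperHalfPlane} (hγ : Isometry γ)
    (hfr : Set.range γ ⊆ frontier O.cover) {g : UpperHalfPlane ≃ᵢ UpperHalfPlane} (hg : g ∈ O.pi1)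
    (h : g '' Set.range γ = Set.range γ) : ∃ c, ∀ t, g (γ t) = γ (t + c) := by
  have hex : ∀ t, ∃ s, γ s = g (γ t) := fun t => by
    have : g (γ t) ∈ g '' Set.range γ := ⟨γ t, ⟨t, rfl⟩, rfl⟩
    rw [h] at this
    exact this
  choose τ hτ using hex
  have hd : ∀ s t, |τ s - τ t| = |s - t| := fun s t => by
    rw [← Real.dist_eq, ← Real.dist_eq, ← hγ.dist_eq, ← hγ.dist_eq, hτ, hτ, g.dist_eq]
  have h10 := hd 1 0
  rw [sub_zero, abs_one] at h10
  rcases (abs_eq zero_le_one).1 h10 with h1 | h1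
  · refine ⟨τ 0, fun t => ?_⟩
    rw [← hτ]
    congr 1
    have h2 := hd t 0
    have h3 := hd t 1
    rw [← sq_eq_sq_iff_abs_eq_abs] at h2 h3
    have : τ 1 = τ 0 + 1 := by linarith
    rw [this] at h3
    linarith
  · refine (O.not_flip hrefl hγ hfr hg (c := τ 0) fun t => ?_).elim
    rw [← hτ]
    congr 1
    have h2 := hd t 0
    have h3 := hd t 1
    rw [← sq_eq_sq_iff_abs_eq_abs] at h2 h3
    have : τ 1 = τ 0 - 1 := by linarith
    rw [this] at h3
    linarith

theorem image_range_of_translation {γ : ℝ → UpperHalfPlane}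
    {g : UpperHalfPlane ≃ᵢ UpperHalfPlane} {c : ℝ} (h : ∀ t, g (γ t) = γ (t + c)) :
    g '' Set.range γ = Set.range γ := by
  ext x
  constructor
  · rintro ⟨_, ⟨t, rfl⟩, rfl⟩
    exact ⟨t + c, (h t).symm⟩
  · rintro ⟨t, rfl⟩
    exact ⟨_, ⟨t - c, rfl⟩, by rw [h, sub_add_cancel]⟩

theorem translation_zpow {γ : ℝ → UpperHalfPlane} {g : UpperHalfPlane ≃ᵢ UpperHalfPlane} {c : ℝ}
    (h : ∀ t, g (γ t) = γ (t + c)) (k : ℤ) (t : ℝ) : (g ^ k) (γ t) = γ (t + k * c) := by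
  have hinv : ∀ t, g⁻¹ (γ t) = γ (t - c) := fun t => by
    have := h (t - c)
    rw [sub_add_cancel] at this
    rw [← this]
    exact g.symm_apply_apply _
  induction k generalizing t with
  | zero => simp
  | succ k ih =>
    rw [zpow_add_one]
    change (g ^ (k : ℤ)) (g (γ t)) = _
    rw [h, ih]
    congr 1
    push_cast
    ring
  | pred k ih =>
    rw [zpow_sub_one]
    change (g ^ (-(k : ℤ))) (g⁻¹ (γ t)) = _
    rw [hinv, ih]
    congr 1
    push_cast
    ring

/-- The stabiliser of a boundary geodesic is generated by a translation along it. -/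
theorem exists_generator (hrefl : O.HasNoReflectors) {γ : ℝ → UpperHalfPlane} (hγ : Isometry γ)
    (hfr : Set.range γ ⊆ frontier O.cover) : ∃ (d : O.pi1) (c : ℝ),
      O.boundarySubgroup (Set.range γ) = Subgroup.zpowers d ∧ ∀ t, d.1 (γ t) = γ (t + c) := by
  let S : AddSubgroup ℝ :=
    { carrier := {c | ∃ g ∈ O.pi1, ∀ t, g (γ t) = γ (t + c)}
      zero_mem' := ⟨1, one_mem _, fun t => by rw [add_zero]; rfl⟩
      add_mem' := by
        rintro a b ⟨g, hg, h⟩ ⟨g', hg', h'⟩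
        refine ⟨g * g', mul_mem hg hg', fun t => ?_⟩
        change g (g' (γ t)) = _
        rw [h', h, add_assoc, add_comm b]
      neg_mem' := by
        rintro a ⟨g, hg, h⟩
        refine ⟨g⁻¹, inv_mem hg, fun t => ?_⟩
        have := translation_zpow h (-1) t
        rw [zpow_neg_one] at this
        rw [this]
        congr 1
        push_cast
        ring }
  -- A dense group of translation lengths would have infinitely many elements in `[-1, 1]`, against
  -- proper discontinuity.
  have hcyc : ∃ a, S = AddSubgroup.closure {a} := by
    refine (AddSubgroup.dense_or_cyclic S).resolve_left fun hdense => ?_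
    have hK : IsCompact (γ '' Set.Icc (-1) 1) := isCompact_Icc.image hγ.continuous
    have hKs : γ '' Set.Icc (-1) 1 ⊆ O.cover :=
      (Set.image_subset_range _ _).trans (hfr.trans O.frontier_subset)
    have hfin := O.properlyDiscontinuous _ hK hKs
    have hF : ((S : Set ℝ) ∩ Set.Icc (-1) 1).Finite := by
      choose! φ hφ hφt using fun (c : ℝ) (hc : c ∈ S) => hc
      refine Set.Finite.of_finite_image (f := φ) (hfin.subset ?_) ?_
      · rintro _ ⟨c, ⟨hc, hcI⟩, rfl⟩
        refine ⟨hφ c hc, γ c, ⟨γ 0, ⟨0, by norm_num, rfl⟩, ?_⟩, ⟨c, hcI, rfl⟩⟩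
        rw [hφt c hc, zero_add]
      · rintro a ⟨ha, -⟩ b ⟨hb, -⟩ hab
        have h1 := hφt a ha 0
        rw [hab, hφt b hb 0] at h1
        have := hγ.injective h1
        linarith
    have hopen : IsOpen (Set.Ioo (0 : ℝ) 1 \ ((S : Set ℝ) ∩ Set.Icc (-1) 1)) :=
      isOpen_Ioo.sdiff hF.isClosed
    have hne : (Set.Ioo (0 : ℝ) 1 \ ((S : Set ℝ) ∩ Set.Icc (-1) 1)).Nonempty :=
      ((Set.Ioo_infinite (zero_lt_one' ℝ)).sdiff hF).nonempty
    obtain ⟨c, hcS, hc⟩ := hdense.exists_mem_open hopen hne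
    exact hc.2 ⟨hcS, by linarith [hc.1.1], hc.1.2.le⟩
  obtain ⟨a, ha⟩ := hcyc
  have haS : a ∈ S := ha ▸ AddSubgroup.subset_closure rfl
  obtain ⟨d, hd, hdt⟩ := haS
  refine ⟨⟨d, hd⟩, a, ?_, hdt⟩
  ext g
  constructor
  · intro hg
    obtain ⟨c, hc⟩ := O.exists_translation hrefl hγ hfr g.2 hg
    have hcS : c ∈ S := ⟨g, g.2, hc⟩
    rw [ha, AddSubgroup.mem_closure_singleton] at hcS
    obtain ⟨k, hk⟩ := hcS
    refine ⟨k, ?_⟩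
    have h1 : (d ^ k)⁻¹ * g.1 = 1 := by
      refine O.eq_one_of_fixes_line hrefl hγ (mul_mem (inv_mem (zpow_mem hd k)) g.2) fun t => ?_
      change (d ^ k)⁻¹ (g.1 (γ t)) = γ t
      rw [hc, ← zpow_neg, translation_zpow hdt, ← hk, zsmul_eq_mul]
      congr 1
      push_cast
      ring
    exact Subtype.ext (inv_mul_eq_one.1 h1)
  · rintro ⟨k, rfl⟩
    exact image_range_of_translation (translation_zpow hdt k)

/-- `δ` preserves the distance to `γ`, so `lineForm γ` has the same absolute value at `g (γ (t -
c))`, `g (γ t)` and `g (γ (t + c))`. As `cosh c > 1`, the addition law makes it zero. -/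
theorem mem_boundarySubgroup_of_commute {γ : ℝ → UpperHalfPlane} (hγ : Isometry γ)
    {g δ : UpperHalfPlane ≃ᵢ UpperHalfPlane} {c : ℝ} (hc : c ≠ 0)
    (hδ : ∀ t, δ (γ t) = γ (t + c)) (h : g * δ = δ * g) :
    g '' Set.range γ = Set.range γ := by
  have hcomm : ∀ x, g (δ x) = δ (g x) := fun x => congrArg (fun f => f x) h
  have hgγ : Isometry (g ∘ γ) := g.isometry.comp hγ
  -- `δ` preserves the distance to the line
  have hinv : ∀ u, lineForm γ (vec (δ u)) ^ 2 = lineForm γ (vec u) ^ 2 := by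
    intro u
    have h1 : det3 (vec (γ c)) (vec (γ (1 + c))) (vec (δ u)) ^ 2 =
        det3 (vec (γ 0)) (vec (γ 1)) (vec u) ^ 2 := by
      refine det3_sq_eq_of_dist ?_ ?_ ?_
      · rw [hγ.dist_eq, hγ.dist_eq, Real.dist_eq, Real.dist_eq]; congr 1; ring
      · have := hδ 0
        rw [zero_add] at this
        rw [← this, δ.dist_eq]
      · rw [← hδ 1, δ.dist_eq]
    have h2 : det3 (vec (γ c)) (vec (γ (1 + c))) (vec (δ u)) =
        det3 (vec (γ 0)) (vec (γ 1)) (vec (δ u)) := by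
      have hs : Real.sinh 1 ≠ 0 := (Real.sinh_pos_iff.2 one_pos).ne'
      have e1 := sinh_smul_vec_line hγ 0 1 c
      have e2 := sinh_smul_vec_line hγ 0 1 (1 + c)
      rw [sub_zero, sub_zero] at e1 e2
      have e3 : (1 : ℝ) - (1 + c) = -c := by ring
      rw [e3, Real.sinh_neg] at e2
      have key : ∀ (s : ℝ) (a b v : ℝ × ℝ × ℝ), det3 (s • a) (s • b) v = s ^ 2 * det3 a b v := by
        intro s a b v
        simp [det3]; ring
      have key2 : ∀ (p q r s : ℝ) (a b v : ℝ × ℝ × ℝ),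
          det3 (p • a + q • b) (r • a + s • b) v = (p * s - q * r) * det3 a b v := by
        intro p q r s a b v
        simp [det3]; ring
      refine mul_left_cancel₀ (pow_ne_zero 2 hs) ?_
      rw [← key, e1, e2, key2]
      congr 1
      have := Real.cosh_sq_sub_sinh_sq c
      have h1 := Real.cosh_sq_sub_sinh_sq 1
      rw [Real.sinh_sub, Real.sinh_add]
      linear_combination Real.sinh 1 ^ 2 * this - Real.sinh c ^ 2 * h1
    rw [h2] at h1
    exact h1
  have hzero : ∀ t, lineForm γ (vec (g (γ t))) = 0 := by
    intro t
    have h1 := map_line_add_map_line hgγ (lineForm γ) t c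
    simp only [Function.comp] at h1
    have h2 : lineForm γ (vec (g (γ (t + c)))) ^ 2 = lineForm γ (vec (g (γ t))) ^ 2 := by
      rw [← hδ, hcomm, hinv]
    have h3 : lineForm γ (vec (g (γ t))) ^ 2 = lineForm γ (vec (g (γ (t - c)))) ^ 2 := by
      have := hδ (t - c)
      rw [sub_add_cancel] at this
      rw [← this, hcomm, hinv]
    set f := lineForm γ (vec (g (γ t)))
    set f₁ := lineForm γ (vec (g (γ (t + c))))
    set f₂ := lineForm γ (vec (g (γ (t - c))))
    have hC := Real.one_lt_cosh.2 hc
    have h4 : (2 * Real.cosh c * f) ^ 2 ≤ 4 * f ^ 2 := by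
      rw [← h1]
      nlinarith [sq_nonneg (f₁ - f₂)]
    have h5 : (Real.cosh c ^ 2 - 1) * f ^ 2 ≤ 0 := by nlinarith
    have h6 : 0 < Real.cosh c ^ 2 - 1 := by nlinarith
    have h7 : f ^ 2 = 0 := le_antisymm (by
      by_contra! h
      exact absurd (mul_pos h6 h) (not_lt.2 h5)) (sq_nonneg f)
    exact pow_eq_zero_iff two_ne_zero |>.1 h7
  rw [← Set.range_comp]
  exact range_eq_of_mem hγ hgγ zero_ne_one (mem_range_of_lineForm hγ (hzero 0))
    (mem_range_of_lineForm hγ (hzero 1))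

end HyperbolicTwoOrbifold

namespace UpperHalfPlane

/-! ### Half-planes and segments -/

theorem exists_zero_between (f : (ℝ × ℝ × ℝ) →ₗ[ℝ] ℝ) (g : UpperHalfPlane ≃ᵢ UpperHalfPlane)
    {p r : UpperHalfPlane} (hp : f (vec (g p)) ≤ 0) (hr : 0 < f (vec (g r))) :
    ∃ u, dist p u + dist u r = dist p r ∧ f (vec (g u)) = 0 := by
  obtain ⟨m, hm, hm0, -⟩ := exists_zero_on_segment f hp hr
  refine ⟨g.symm m, ?_, by rw [g.apply_symm_apply]; exact hm0⟩
  rw [← g.dist_eq, ← g.dist_eq (g.symm m), g.apply_symm_apply, hm, g.dist_eq]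

theorem map_combination (f : (ℝ × ℝ × ℝ) →ₗ[ℝ] ℝ) (g : UpperHalfPlane ≃ᵢ UpperHalfPlane)
    {p r u : UpperHalfPlane} (hu : dist p u + dist u r = dist p r) :
    ∃ a b : ℝ, 0 ≤ a ∧ 0 ≤ b ∧ 0 < a + b ∧
      f (vec (g u)) = a * f (vec (g p)) + b * f (vec (g r)) := by
  rw [← g.dist_eq, ← g.dist_eq u, ← g.dist_eq p] at hu
  obtain ⟨a, b, ha, hb, h, ha', hb'⟩ := exists_combination hu
  refine ⟨a, b, ha, hb, ?_, by rw [h, map_add, map_smul, map_smul, smul_eq_mul, smul_eq_mul]⟩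
  by_contra! h0
  have ha0 : a = 0 := by linarith
  have hb0 : b = 0 := by linarith
  have h1 := lform_vec_self (g u)
  rw [h, ha0, hb0, zero_smul, zero_smul, add_zero] at h1
  simp [lform] at h1

theorem exists_mem_Icc_of_between {γ : ℝ → UpperHalfPlane} (hγ : Isometry γ) {a b : ℝ}
    (hab : a ≤ b) {u : UpperHalfPlane}
    (hu : dist (γ a) u + dist u (γ b) = dist (γ a) (γ b)) : ∃ t ∈ Set.Icc a b, u = γ t := by
  have h0 : lineForm γ (vec u) = 0 := by
    obtain ⟨p, q, -, -, h, -⟩ := exists_combination hu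
    rw [h, map_add, map_smul, map_smul, lineForm_line hγ, lineForm_line hγ, smul_zero, smul_zero,
      add_zero]
  obtain ⟨t, rfl⟩ := mem_range_of_lineForm hγ h0
  rw [hγ.dist_eq, hγ.dist_eq, hγ.dist_eq, Real.dist_eq, Real.dist_eq, Real.dist_eq,
    abs_of_nonpos (sub_nonpos.2 hab)] at hu
  refine ⟨t, ⟨?_, ?_⟩, rfl⟩
  · linarith [neg_abs_le (a - t), le_abs_self (a - t), neg_abs_le (t - b), le_abs_self (t - b)]
  · linarith [neg_abs_le (a - t), le_abs_self (a - t), neg_abs_le (t - b), le_abs_self (t - b)]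

theorem isCompact_between (p r : UpperHalfPlane) :
    IsCompact {u | dist p u + dist u r = dist p r} := by
  refine (isCompact_closedBall p (dist p r)).of_isClosed_subset
    (isClosed_eq (by fun_prop) continuous_const) fun u hu => ?_
  rw [Metric.mem_closedBall, dist_comm]
  have h : dist p u + dist u r = dist p r := hu
  linarith [dist_nonneg (x := u) (y := r)]

end UpperHalfPlane

namespace HyperbolicTwoOrbifold

open UpperHalfPlane

variable (O : HyperbolicTwoOrbifold)

/-! ### The splitting dual to an arc -/

/-- The translates under `N` of one side of the zero set of a linear functional are nested if the
translates of the zero set are disjoint, and only one of them crosses the boundary geodesic in each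
period of the stabiliser. -/
theorem isNestedHalf {γ : ℝ → UpperHalfPlane} (hγ : Isometry γ)
    (hfr : Set.range γ ⊆ frontier O.cover) (N : Subgroup O.pi1) (σ : (ℝ × ℝ × ℝ) →ₗ[ℝ] ℝ)
    {c : ℝ} (hc : 0 < c) {d : N} (hd : ∀ t, d.1.1 (γ t) = γ (t + c))
    (hdisj : ∀ n : N, ∀ z ∈ O.cover, σ (vec z) = 0 → σ (vec (n.1.1 z)) = 0 → n = 1)
    (hline : ∀ n : N, ∀ t, σ (vec (n.1.1 (γ t))) = 0 → ∃ k : ℤ, n = d ^ k ∧ t + k * c = 0)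
    (hpos : 0 < σ (vec (γ (c / 2)))) (hneg : σ (vec (γ (-(c / 2)))) ≤ 0)
    (hcpt : IsCompact {z ∈ O.cover | σ (vec z) = 0}) :
    IsNestedHalf {n : N | 0 < σ (vec (n.1.1 (γ (-(c / 2)))))} d := by
  set x := γ (-(c / 2)) with hx
  have hxX : ∀ n : N, n.1.1 x ∈ O.cover := fun n =>
    O.map_mem_cover n.1.2 (O.frontier_subset (hfr ⟨_, rfl⟩))
  have hdx : d.1.1 x = γ (c / 2) := by rw [hx, hd]; congr 1; ring
  have hseg : ∀ {p r u : UpperHalfPlane}, p ∈ O.cover → r ∈ O.cover →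
      dist p u + dist u r = dist p r → u ∈ O.cover := fun hp hr h => O.convex_cover _ hp _ hr _ h
  have hcross : ∀ (m : N) (p r : UpperHalfPlane),
      ¬(0 < σ (vec (m.1.1 p)) ↔ 0 < σ (vec (m.1.1 r))) →
      ∃ u, dist p u + dist u r = dist p r ∧ σ (vec (m.1.1 u)) = 0 := by
    intro m p r h
    rcases lt_or_ge 0 (σ (vec (m.1.1 p))) with hp | hp
    · have hr : σ (vec (m.1.1 r)) ≤ 0 := not_lt.1 fun hr => h ⟨fun _ => hr, fun _ => hp⟩
      obtain ⟨u, hu, hu0⟩ := exists_zero_between σ m.1.1 hr hp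
      exact ⟨u, by rw [dist_comm p r, ← hu, dist_comm r u, dist_comm p u, add_comm], hu0⟩
    · have hr : 0 < σ (vec (m.1.1 r)) := by
        by_contra hr
        exact h ⟨fun h' => absurd h' (not_lt.2 hp), fun h' => absurd h' hr⟩
      exact exists_zero_between σ m.1.1 hp hr
  refine ⟨not_lt.2 hneg, ?_, fun m hm => ?_, fun g => ?_, ?_⟩
  · change 0 < σ (vec (d.1.1 x))
    rwa [hdx]
  · by_contra hne
    obtain ⟨u, hu, hu0⟩ := hcross m (d.1.1 x) x hne
    rw [hdx] at hu
    have hu' : dist x u + dist u (γ (c / 2)) = dist x (γ (c / 2)) := by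
      rw [add_comm, dist_comm u, dist_comm x u, dist_comm x]
      exact hu
    obtain ⟨t, ⟨ht1, ht2⟩, rfl⟩ := exists_mem_Icc_of_between hγ (by linarith) hu'
    obtain ⟨k, rfl, hk⟩ := hline m t hu0
    refine hm ?_
    -- The crossing parameter satisfies `|t| ≤ c / 2`, less than one period.
    have hk0 : k = 0 := by
      by_contra hk0
      rcases lt_or_gt_of_ne hk0 with h | h
      · have : (k : ℝ) ≤ -1 := by exact_mod_cast Int.le_sub_one_of_lt h
        nlinarith
      · have : (1 : ℝ) ≤ k := by exact_mod_cast h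
        nlinarith
    rw [hk0, zpow_zero]
  · set K := {u | dist x u + dist u (g.1.1 x) = dist x (g.1.1 x)} ∪ {z ∈ O.cover | σ (vec z) = 0}
    have hKX : K ⊆ O.cover := Set.union_subset
      (fun u hu => hseg (hxX 1) (hxX g) hu) (Set.sep_subset _ _)
    have hfin := O.properlyDiscontinuous K ((isCompact_between _ _).union hcpt) hKX
    refine ((hfin.preimage Subtype.val_injective.injOn).preimage
      (Subtype.val_injective (p := fun n => n ∈ N)).injOn).subset fun m hm => ?_
    obtain ⟨u, hu, hu0⟩ := hcross m x (g.1.1 x) hm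
    have huX : u ∈ O.cover := hseg (hxX 1) (hxX g) hu
    exact ⟨m.1.2, _, ⟨u, Or.inl hu, rfl⟩, Or.inr ⟨O.map_mem_cover m.1.2 huX, hu0⟩⟩
  · intro u v huv a b c' e h1 h2 h3 h4 h5 h6 h7
    by_contra h8
    replace h1 : 0 < σ (vec (u.1.1 (a.1.1 x))) := h1
    replace h2 : 0 < σ (vec (v.1.1 (a.1.1 x))) := h2
    replace h3 : 0 < σ (vec (u.1.1 (b.1.1 x))) := h3
    replace h6 : 0 < σ (vec (v.1.1 (c'.1.1 x))) := h6
    replace h4 : σ (vec (v.1.1 (b.1.1 x))) ≤ 0 := not_lt.1 h4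
    replace h5 : σ (vec (u.1.1 (c'.1.1 x))) ≤ 0 := not_lt.1 h5
    replace h7 : σ (vec (u.1.1 (e.1.1 x))) ≤ 0 := not_lt.1 h7
    replace h8 : σ (vec (v.1.1 (e.1.1 x))) ≤ 0 := not_lt.1 h8
    -- Four occupied corners give two points on the zero set belonging to `u`, on different sides of
    -- the one belonging to `v`. The segment between them meets both zero sets, against `hdisj`.
    obtain ⟨w₁, hw₁, hw₁0⟩ := exists_zero_between σ u.1.1 h5 h1
    obtain ⟨w₂, hw₂, hw₂0⟩ := exists_zero_between σ u.1.1 h7 h3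
    have hv₁ : 0 < σ (vec (v.1.1 w₁)) := by
      obtain ⟨p, q, hp, hq, hpq, h⟩ := map_combination σ v.1.1 hw₁
      rw [h]
      rcases hp.lt_or_eq with hp' | hp'
      · have := mul_pos hp' h6
        have := mul_nonneg hq h2.le
        linarith
      · have := mul_pos (show 0 < q by linarith) h2
        rw [← hp']
        linarith
    have hv₂ : σ (vec (v.1.1 w₂)) ≤ 0 := by
      obtain ⟨p, q, hp, hq, -, h⟩ := map_combination σ v.1.1 hw₂
      rw [h]
      have := mul_nonneg hp (neg_nonneg.2 h8)
      have := mul_nonneg hq (neg_nonneg.2 h4)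
      linarith
    obtain ⟨w, hw, hw0⟩ := exists_zero_between σ v.1.1 hv₂ hv₁
    have hwX : w ∈ O.cover :=
      hseg (hseg (hxX e) (hxX b) hw₂) (hseg (hxX c') (hxX a) hw₁) hw
    have huw : σ (vec (u.1.1 w)) = 0 := by
      obtain ⟨p, q, -, -, -, h⟩ := map_combination σ u.1.1 hw
      rw [h, hw₁0, hw₂0, mul_zero, mul_zero, add_zero]
    have hone := hdisj (v * u⁻¹) (u.1.1 w) (O.map_mem_cover u.1.2 hwX) huw (by
      have e1 : (v * u⁻¹).1.1 (u.1.1 w) = v.1.1 w :=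
        congrArg v.1.1 (u.1.1.symm_apply_apply w)
      rw [e1]
      exact hw0)
    exact huv (mul_inv_eq_one.1 hone).symm

end HyperbolicTwoOrbifold

namespace HyperbolicTwoOrbifold

open UpperHalfPlane

variable (O : HyperbolicTwoOrbifold)

/-! ### Arcs between boundary geodesics -/

section Arc

variable {γ δ : ℝ → UpperHalfPlane} (hγ : Isometry γ) (hδ : Isometry δ)
  (hγfr : Set.range γ ⊆ frontier O.cover) (hδfr : Set.range δ ⊆ frontier O.cover)
  (hne : Set.range δ ≠ Set.range γ) {x y : UpperHalfPlane} (hx : x ∈ Set.range γ)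
  (hy : y ∈ Set.range δ)

include hγ hδ hγfr hδfr hne hx hy

/-- The cover lies on one side of `γ` and of `δ`, so the line through `x` and `y` leaves it beyond
both points. -/
theorem arc_combination {z : UpperHalfPlane} (hz : z ∈ O.cover)
    (h : detForm (vec x) (vec y) (vec z) = 0) :
    ∃ a b : ℝ, 0 ≤ a ∧ 0 ≤ b ∧ vec z = a • vec x + b • vec y := by
  obtain ⟨s, rfl⟩ := hx
  obtain ⟨t, rfl⟩ := hy
  have hyγ : δ t ∉ Set.range γ := fun h => hne (O.range_eq_of_meet hγ hδ hγfr hδfr h)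
  have hxδ : γ s ∉ Set.range δ := fun h => hne (O.range_eq_of_meet hδ hγ hδfr hγfr h).symm
  have hxy : γ s ≠ δ t := fun h => hyγ ⟨s, h⟩
  obtain ⟨a, b, hab⟩ := exists_combination_of_det3 hxy h
  refine ⟨a, b, ?_, ?_, hab⟩
  · have h1 := O.same_side hδ hδfr (O.frontier_subset (hγfr ⟨s, rfl⟩)) hz
    rw [hab, map_add, map_smul, map_smul, lineForm_line hδ, smul_zero, add_zero, smul_eq_mul] at h1
    rw [← lineForm_eq_zero_iff hδ] at hxδ
    have : 0 < lineForm δ (vec (γ s)) ^ 2 := by positivity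
    by_contra! ha
    nlinarith
  · have h1 := O.same_side hγ hγfr (O.frontier_subset (hδfr ⟨t, rfl⟩)) hz
    rw [hab, map_add, map_smul, map_smul, lineForm_line hγ, smul_zero, zero_add, smul_eq_mul] at h1
    rw [← lineForm_eq_zero_iff hγ] at hyγ
    have : 0 < lineForm γ (vec (δ t)) ^ 2 := by positivity
    by_contra! hb
    nlinarith

theorem isCompact_arc :
    IsCompact {z ∈ O.cover | detForm (vec x) (vec y) (vec z) = 0} := by
  refine (isCompact_closedBall x (dist x y)).of_isClosed_subset
    (O.isClosed_cover.inter (isClosed_eq ?_ continuous_const)) fun z hz => ?_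
  · exact (LinearMap.continuous_of_finiteDimensional _).comp continuous_vec
  · obtain ⟨a, b, ha, hb, h⟩ := O.arc_combination hγ hδ hγfr hδfr hne hx hy hz.1 hz.2
    have := dist_add_dist_of_combination ha hb h
    rw [Metric.mem_closedBall, dist_comm]
    linarith [dist_nonneg (x := z) (y := y)]

/-- A boundary geodesic through an inner point of the arc contains both ends, hence equals `δ`; at
an end, boundary geodesics that meet coincide. -/
theorem arc_meets {μ : ℝ → UpperHalfPlane} (hμ : Isometry μ)
    (hμfr : Set.range μ ⊆ frontier O.cover) {z : UpperHalfPlane} (hz : z ∈ O.cover)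
    (h : detForm (vec x) (vec y) (vec z) = 0) (hzμ : z ∈ Set.range μ) :
    (z = x ∧ Set.range μ = Set.range γ) ∨ Set.range μ = Set.range δ := by
  obtain ⟨a, b, ha, hb, hab⟩ := O.arc_combination hγ hδ hγfr hδfr hne hx hy hz h
  have hmeet : ∀ {ν : ℝ → UpperHalfPlane}, Isometry ν → Set.range ν ⊆ frontier O.cover →
      ∀ {w}, w ∈ Set.range μ → w ∈ Set.range ν → Set.range μ = Set.range ν := by
    rintro ν hν hνfr _ ⟨t, rfl⟩ hw
    exact O.range_eq_of_meet hν hμ hνfr hμfr hw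
  have hunit : ∀ {w : UpperHalfPlane} {r : ℝ}, 0 ≤ r → vec z = r • vec w → z = w := by
    intro w r hr h
    have h1 := lform_vec_self z
    rw [h, lform_smul_left, lform_smul_right, lform_vec_self, mul_one] at h1
    have : r = 1 := by nlinarith
    rw [this, one_smul] at h
    exact vec_injective h
  rcases ha.eq_or_lt with rfl | ha
  · rw [zero_smul, zero_add] at hab
    obtain rfl := hunit hb hab
    exact Or.inr (hmeet hδ hδfr hzμ hy)
  rcases hb.eq_or_lt with rfl | hb
  · rw [zero_smul, add_zero] at hab
    obtain rfl := hunit ha.le hab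
    exact Or.inl ⟨rfl, hmeet hγ hγfr hzμ hx⟩
  · obtain ⟨-, h2⟩ := O.mem_range_of_combination hμ hμfr (O.frontier_subset (hγfr hx))
      (O.frontier_subset (hδfr hy)) ha hb hab hzμ
    exact Or.inr (hmeet hδ hδfr h2 hy)

end Arc

theorem boundarySubgroup_eq_top {L : Set UpperHalfPlane} (h : frontier O.cover = L) :
    O.boundarySubgroup L = ⊤ := by
  rw [eq_top_iff]
  intro g _
  change g.1 '' L = L
  rw [← h]
  exact O.image_frontier g.2

/-- The generator of the stabiliser of a boundary geodesic is conjugacy `p`-distinguished, if there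
is a second boundary geodesic. -/
theorem isConjPDistinguished_zpowers {p : ℕ} (hp : p.Prime)
    (hres : IsResiduallyP p O.pi1) {γ δ : ℝ → UpperHalfPlane} (hγ : Isometry γ) (hδ : Isometry δ)
    (hγfr : Set.range γ ⊆ frontier O.cover) (hδfr : Set.range δ ⊆ frontier O.cover)
    (hne : Set.range δ ≠ Set.range γ) {d : O.pi1} {c : ℝ} (hc : 0 < c)
    (hd : ∀ t, d.1 (γ t) = γ (t + c))
    (hD : O.boundarySubgroup (Set.range γ) = Subgroup.zpowers d) :
    IsConjPDistinguished p (Subgroup.zpowers d : Set O.pi1) := by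
  have hx : γ 0 ∈ Set.range γ := ⟨0, rfl⟩
  have hy : δ 0 ∈ Set.range δ := ⟨0, rfl⟩
  set σ := detForm (vec (γ 0)) (vec (δ 0)) with hσ
  have hcpt := O.isCompact_arc hγ hδ hγfr hδfr hne hx hy
  have hmeets := fun {μ : ℝ → UpperHalfPlane} =>
    O.arc_meets hγ hδ hγfr hδfr hne hx hy (μ := μ)
  rw [← hσ] at hcpt hmeets
  have hzp : ∀ (k : ℤ) t, (d ^ k).1 (γ t) = γ (t + k * c) := fun k t => by
    rw [Subgroup.coe_zpow]
    exact translation_zpow hd k t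
  have hmem : ∀ g : O.pi1, g.1 '' Set.range γ = Set.range γ → g ∈ Subgroup.zpowers d :=
    fun g hg => hD ▸ hg
  have hcent : ∀ g, ∀ δ ∈ Subgroup.zpowers d, δ ≠ 1 → g * δ = δ * g →
      g ∈ Subgroup.zpowers d := by
    rintro g _ ⟨k, rfl⟩ hk h
    have hk0 : k ≠ 0 := by
      rintro rfl
      exact hk (zpow_zero d)
    exact hmem g (mem_boundarySubgroup_of_commute hγ (c := k * c)
      (mul_ne_zero (Int.cast_ne_zero.2 hk0) hc.ne') (hzp k) (congrArg Subtype.val h))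
  have hdfin : ¬IsOfFinOrder d := by
    intro h
    obtain ⟨k, hk, hk1⟩ := isOfFinOrder_iff_pow_eq_one.1 h
    have h1 := hzp k 0
    rw [zpow_natCast, hk1, zero_add] at h1
    have h2 : (0 : ℝ) = (k : ℤ) * c := hγ.injective h1
    have : (0 : ℝ) < k := by exact_mod_cast hk
    push_cast at h2
    nlinarith
  have hd1 : d ≠ 1 := by
    rintro rfl
    exact hdfin IsOfFinOrder.one
  -- a finite `p`-quotient in which the two geodesics are separated
  have hsep : ∃ T : Set O.pi1, T.Finite ∧ (∀ g ∈ T, g ≠ 1) ∧ ∀ (Q : Type) [Group Q] (q : O.pi1 →* Q),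
      (∀ g ∈ T, q g ≠ 1) → ∀ n ∈ q.ker, n.1 '' Set.range γ ≠ Set.range δ := by
    by_cases hex : ∃ g : O.pi1, g.1 '' Set.range γ = Set.range δ
    · obtain ⟨g, hg⟩ := hex
      -- The commutator of `g` and `d` is nontrivial, as `g` moves `γ`. If `n` in the kernel carried
      -- `γ` to `δ = g γ`, then `q g` would be a power of `q d` and the commutator would die.
      refine ⟨{g * d * (d * g)⁻¹}, Set.finite_singleton _, ?_, fun Q _ q hq n hn hnL => ?_⟩
      · rintro _ rfl h
        have := hcent g d (Subgroup.mem_zpowers d) hd1 (mul_inv_eq_one.1 h)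
        rw [← hD] at this
        exact hne (hg.symm.trans this)
      · have h1 : g⁻¹ * n ∈ Subgroup.zpowers d := by
          apply hmem
          change (g.1.symm ∘ n.1) '' _ = _
          rw [Set.image_comp, hnL, ← hg, ← Set.image_comp]
          simp
        obtain ⟨k, hk⟩ := h1
        refine hq _ rfl ?_
        have h2 : q g = (q d ^ k)⁻¹ := by
          have := congrArg q hk
          rw [map_mul, map_inv, MonoidHom.mem_ker.1 hn, mul_one] at this
          simp only [map_zpow] at this
          rw [this, inv_inv]
        rw [map_mul, map_inv, map_mul, map_mul, mul_inv_eq_one, h2]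
        exact ((Commute.refl (q d)).zpow_left k).inv_left.eq
    · push Not at hex
      exact ⟨∅, Set.finite_empty, by simp, fun _ _ _ _ n _ => hex n⟩
  obtain ⟨T, hT, hT1, hTsep⟩ := hsep
  set α := {z ∈ O.cover | σ (vec z) = 0} with hα
  have hTα : {n : O.pi1 | n ≠ 1 ∧ (n.1 '' α ∩ α).Nonempty}.Finite :=
    ((O.properlyDiscontinuous α hcpt (Set.sep_subset _ _)).preimage
      Subtype.val_injective.injOn).subset fun n hn => ⟨n.2, hn.2⟩
  obtain ⟨Q, _, _, q, hQ, hq⟩ := hres.exists_hom (hT.union hTα) (by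
    rintro g (hg | hg)
    · exact hT1 g hg
    · exact hg.1)
  have hqL := hTsep Q q fun g hg => hq g (Or.inl hg)
  -- `d ^ m` generates the intersection of `⟨d⟩` with the kernel.
  set m := orderOf (q d) with hm
  have hm0 : 0 < m := orderOf_pos _
  let d' : q.ker := ⟨d ^ m, by rw [MonoidHom.mem_ker, map_pow, hm, pow_orderOf_eq_one]⟩
  have hd' : ∀ n : q.ker, (n : O.pi1) ∈ Subgroup.zpowers d → ∃ k : ℤ, n = d' ^ k := by
    rintro ⟨_, hn⟩ ⟨k, rfl⟩
    have h1 : q d ^ k = 1 := by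
      rw [← map_zpow]
      exact hn
    obtain ⟨j, rfl⟩ := orderOf_dvd_iff_zpow_eq_one.2 h1
    refine ⟨j, Subtype.ext ?_⟩
    simp only [d', Subgroup.coe_zpow]
    rw [zpow_mul, zpow_natCast]
  have hc' : 0 < m * c := mul_pos (Nat.cast_pos.2 hm0) hc
  have hd't : ∀ t, d'.1.1 (γ t) = γ (t + m * c) := fun t => by
    have := hzp m t
    rw [zpow_natCast] at this
    exact_mod_cast this
  have hd'z : ∀ (k : ℤ) t, (d' ^ k).1.1 (γ t) = γ (t + k * (m * c)) := fun k t => by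
    have h : (d' ^ k).1.1 = d'.1.1 ^ k := by rw [Subgroup.coe_zpow, Subgroup.coe_zpow]
    rw [h]
    exact translation_zpow hd't k t
  have hdisj : ∀ n : q.ker, ∀ z ∈ O.cover, σ (vec z) = 0 → σ (vec (n.1.1 z)) = 0 → n = 1 := by
    intro n z hz hz0 hz1
    by_contra hn
    refine hq n.1 (Or.inr ⟨fun h => hn (Subtype.ext h), n.1.1 z, ⟨z, ⟨hz, hz0⟩, rfl⟩,
      O.map_mem_cover n.1.2 hz, hz1⟩) n.2
  have hline : ∀ n : q.ker, ∀ t, σ (vec (n.1.1 (γ t))) = 0 →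
      ∃ k : ℤ, n = d' ^ k ∧ t + k * (m * c) = 0 := by
    intro n t ht
    rcases hmeets (n.1.1.isometry.comp hγ) (O.range_comp_subset hγfr n.1.2)
      (O.map_mem_cover n.1.2 (O.frontier_subset (hγfr ⟨t, rfl⟩))) ht ⟨t, rfl⟩ with ⟨h1, h2⟩ | h2
    · rw [Set.range_comp] at h2
      obtain ⟨k, rfl⟩ := hd' n (hmem n.1 h2)
      refine ⟨k, rfl, hγ.injective ?_⟩
      rw [← hd'z, h1]
    · rw [Set.range_comp] at h2
      exact (hqL n.1 n.2 h2).elim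
  -- Since `σ` vanishes at `γ 0`, it is odd along `γ`; the points half a period away lie on opposite
  -- sides.
  have hsum := map_line_add_map_line hγ σ 0 (m * c / 2)
  rw [zero_sub, zero_add, hσ, detForm_left, mul_zero, ← hσ] at hsum
  have hnz : σ (vec (γ (m * c / 2))) ≠ 0 := by
    intro h
    obtain ⟨k, -, hk⟩ := hline 1 _ h
    have h2 : (2 * k + 1 : ℝ) * (m * c) = 0 := by linarith
    have h3 : (2 * k + 1 : ℝ) = 0 := (mul_eq_zero.1 h2).resolve_right hc'.ne'
    have h4 : 2 * k + 1 = 0 := by exact_mod_cast h3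
    omega
  have hnested : ∃ A : Set q.ker, IsNestedHalf A d' := by
    rcases lt_or_gt_of_ne hnz with h | h
    · refine ⟨_, O.isNestedHalf hγ hγfr q.ker (-σ) hc' hd't ?_ ?_ ?_ ?_ ?_⟩
      · simpa only [LinearMap.neg_apply, neg_eq_zero] using hdisj
      · simpa only [LinearMap.neg_apply, neg_eq_zero] using hline
      · rw [LinearMap.neg_apply]; linarith
      · rw [LinearMap.neg_apply]; linarith
      · simpa only [LinearMap.neg_apply, neg_eq_zero] using hcpt
    · exact ⟨_, O.isNestedHalf hγ hγfr q.ker σ hc' hd't hdisj hline h (by linarith) hcpt⟩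
  obtain ⟨A, hA⟩ := hnested
  exact isConjPDistinguished_of_normal hp hres hQ q hdfin hcent d' hd'
    (Subgroup.pow_mem _ (Subgroup.mem_zpowers d) m) (hA.exists_hom hp (hres.subgroup _))

end HyperbolicTwoOrbifold

/-! ### The theorem on boundary subgroups -/

theorem mainTheorem8 (p : ℕ) (hp : p.Prime) (O : HyperbolicTwoOrbifold)
    (hbd : O.HasBoundary) (hrefl : O.HasNoReflectors) (hres : IsResiduallyP p O.pi1)
    (L : Set UpperHalfPlane) (hL : O.IsBoundaryLift L) :
    IsCyclic (O.boundarySubgroup L) ∧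
      IsConjPDistinguished p (O.boundarySubgroup L : Set O.pi1) := by
  obtain ⟨⟨γ, hγ, rfl⟩, hfr⟩ := hL
  obtain ⟨d, c, hD, hd⟩ := O.exists_generator hrefl hγ hfr
  refine ⟨hD ▸ inferInstance, ?_⟩
  -- With a single boundary geodesic the stabiliser is the whole group and no `g` needs separating.
  by_cases hfront : frontier O.cover ⊆ Set.range γ
  · intro g hg
    refine (hg g ?_ (IsConj.refl g)).elim
    rw [O.boundarySubgroup_eq_top (hfront.antisymm hfr)]
    trivial
  rw [Set.not_subset] at hfront
  obtain ⟨y, hy, hyγ⟩ := hfront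
  obtain ⟨_, ⟨δ, hδ, rfl⟩, hyδ, hδfr⟩ := O.geodesic_boundary y hy
  have hne : Set.range δ ≠ Set.range γ := fun h => hyγ (h ▸ hyδ)
  -- The arc argument wants a positive translation length: a negative one is reversed by `d⁻¹`, and
  -- length zero means that the stabiliser is trivial.
  rcases lt_trichotomy c 0 with hc | rfl | hc
  · have hinv : ∀ t, (d⁻¹).1 (γ t) = γ (t + -c) := fun t => by
      have := HyperbolicTwoOrbifold.translation_zpow hd (-1) t
      rw [zpow_neg_one] at this
      have e : ((-1 : ℤ) : ℝ) * c = -c := by push_cast; ring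
      rw [e] at this
      exact this
    have hD' : O.boundarySubgroup (Set.range γ) = Subgroup.zpowers d⁻¹ :=
      hD.trans Subgroup.zpowers_inv.symm
    rw [hD']
    exact O.isConjPDistinguished_zpowers hp hres hγ hδ hfr hδfr hne (neg_pos.2 hc) hinv hD'
  · have hd1 : d = 1 := Subtype.ext (O.eq_one_of_fixes_line hrefl hγ d.2 fun t => by
      rw [hd, add_zero])
    rw [hD, hd1]
    intro g hg
    obtain ⟨P, _, _, φ, hP, hφ, hφg⟩ := hres g fun h => hg 1 (one_mem _) (h ▸ IsConj.refl _)
    refine ⟨P, inferInstance, inferInstance, φ, hP, hφ, ?_⟩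
    rintro _ ⟨k, rfl⟩ hk
    have hk' : IsConj (φ g) (φ ((1 : O.pi1) ^ k)) := hk
    rw [one_zpow, map_one] at hk'
    exact hφg (isConj_one_left.1 hk')
  · rw [hD]
    exact O.isConjPDistinguished_zpowers hp hres hγ hδ hfr hδfr hne hc hd hD
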